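/- Let $N\ge 5$ and $2^{**}=\frac{2N}{N-4}$. For an open set $\Omega\subset\mathbb R^N$ let $\mathcal D^{2,2}_0(\Omega)$ be the completion of $C_c^\infty(\Omega)$ (real-valued functions) with respect to the norm $\|\Delta u\|_{L^2(\Omega)}$; write $\|\cdot\|_{\mathcal D}$ for its norm. For a real-valued measurable function $f$ on $\Omega$ put $\alpha_f(s)=|\{x\in\Omega:|f(x)|>s\}|$ for $s>0$, and for $t>0$ put $f^*(t)=\inf\{s>0:\alpha_f(s)<t\}$ and $f^{**}(t)=\frac1t\int_0^t f^*(\tau)\,d\tau$; let $|f|_{(p,q)}=\|t^{\frac1p-\frac1q}f^*(t)\|_{L^q((0,\infty))}$ and $\|f\|_{(p,q)}=\|t^{\frac1p-\frac1q}f^{**}(t)\|_{L^q((0,\infty))}$. The Lorentz space $L^{p,q}(\Omega)$ consists of the (classes of a.e. equal) functions $f$ with $|f|_{(p,q)}<\infty$. Then for every open set $\Omega\subset\mathbb R^N$ there is a continuous embedding $$\mathcal D^{2,2}_0(\Omega)\hookrightarrow L^{2^{**},2}(\Omega).$$ More precisely, there is a constant $C\ge 0$ depending only on $N$ such that, for every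 open $\Omega\subset\mathbb R^N$, there is an injective linear map $J$ from $\mathcal D^{2,2}_0(\Omega)$ to the space of classes of a.e. equal measurable functions on $\Omega$, with $J\varphi=\varphi$ a.e. in $\Omega$ for all $\varphi\in C_c^\infty(\Omega)$, such that for all $u\in\mathcal D^{2,2}_0(\Omega)$ one has $Ju\in L^{2^{**},2}(\Omega)$, $$|Ju|_{(2^{**},2)}\le C\,\|u\|_{\mathcal D}\qquad\text{and}\qquad \|Ju\|_{(2^{**},2)}\le C\,\|u\|_{\mathcal D}.$$ -/

import Mathlib

open MeasureTheory Set TopologicalSpace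
open scoped ENNReal NNReal Distributions Laplacian

noncomputable section

/-! ### Decreasing rearrangements and Lorentz spaces -/

section Lorentz

variable {α : Type*} [MeasurableSpace α]

/-- The distribution function `α_f(s) = μ {x : |f x| > s}`. -/
def distributionFunction (μ : Measure α) (f : α → ℝ) (s : ℝ) : ℝ≥0∞ :=
  μ {x | s < |f x|}

/-- The one-dimensional decreasing rearrangement
`f^*(t) = inf {s > 0 : α_f(s) < t}` for `t > 0` (with `inf ∅ = ∞`), and
`f^*(0) = ess sup |f|`. Its values at negative `t` play no role. -/
def decreasingRearrangement (μ : Measure α) (f : α → ℝ) (t : ℝ) : ℝ≥0∞ :=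
  if 0 < t then
    ⨅ (s : ℝ) (_ : 0 < s ∧ distributionFunction μ f s < ENNReal.ofReal t), ENNReal.ofReal s
  else essSup (fun x => ENNReal.ofReal |f x|) μ

/-- The maximal function `f^{**}(t) = (1 / t) ∫₀ᵗ f^*(τ) dτ`, for `t > 0`. -/
def maximalRearrangement (μ : Measure α) (f : α → ℝ) (t : ℝ) : ℝ≥0∞ :=
  (∫⁻ τ in Ioo (0 : ℝ) t, decreasingRearrangement μ f τ) / ENNReal.ofReal t

/-- The Lorentz quasi-norm `|f|_{(p,q)} = ‖t^{1/p - 1/q} f^*(t)‖_{L^q((0,∞))}`. When `q = ∞`,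
`1 / q.toReal = 0`, as it should be. -/
def lorentzQuasiNorm (p : ℝ) (q : ℝ≥0∞) (μ : Measure α) (f : α → ℝ) : ℝ≥0∞ :=
  eLpNorm
    (fun t : ℝ => ENNReal.ofReal (t ^ (1 / p - 1 / q.toReal)) * decreasingRearrangement μ f t)
    q (volume.restrict (Ioi 0))

/-- The Lorentz norm `‖f‖_{(p,q)} = ‖t^{1/p - 1/q} f^{**}(t)‖_{L^q((0,∞))}`. -/
def lorentzNorm (p : ℝ) (q : ℝ≥0∞) (μ : Measure α) (f : α → ℝ) : ℝ≥0∞ :=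
  eLpNorm
    (fun t : ℝ => ENNReal.ofReal (t ^ (1 / p - 1 / q.toReal)) * maximalRearrangement μ f t)
    q (volume.restrict (Ioi 0))

/-- The Lorentz space `L^{p,q}(μ)`: classes of a.e. equal measurable functions with
`|f|_{(p,q)} < ∞`. -/
def lorentzSpace (p : ℝ) (q : ℝ≥0∞) (μ : Measure α) : Set (α →ₘ[μ] ℝ) :=
  {f | lorentzQuasiNorm p q μ f < ∞}

end Lorentz

/-! ### The Beppo-Levi space -/

section BeppoLevi

/-- `C_c^∞(Ω)` (a copy of the type of test functions, so that it can be given the norm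
`‖Δφ‖_{L²(Ω)}` in place of the test-function topology). -/
def SmoothCompact {N : ℕ} (Ω : Opens (EuclideanSpace ℝ (Fin N))) : Type :=
  𝓓(Ω, ℝ)

variable {N : ℕ} {Ω : Opens (EuclideanSpace ℝ (Fin N))}

instance : AddCommGroup (SmoothCompact Ω) := inferInstanceAs (AddCommGroup 𝓓(Ω, ℝ))

instance : Module ℝ (SmoothCompact Ω) := inferInstanceAs (Module ℝ 𝓓(Ω, ℝ))

/-- The underlying function on `ℝ^N` of an element of `C_c^∞(Ω)`. -/
def SmoothCompact.toFun (φ : SmoothCompact Ω) : EuclideanSpace ℝ (Fin N) → ℝ :=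
  TestFunction.toFun φ

theorem SmoothCompact.contDiff_two (φ : SmoothCompact Ω) : ContDiff ℝ 2 φ.toFun :=
  contDiff_infty.1 (TestFunction.contDiff' φ) 2

theorem SmoothCompact.memLp_laplacian (φ : SmoothCompact Ω) :
    MemLp (Δ φ.toFun) 2 (volume.restrict (Ω : Set (EuclideanSpace ℝ (Fin N)))) := by
  have hcont : Continuous (Δ φ.toFun) := by
    rw [InnerProductSpace.laplacian_eq_iteratedFDeriv_stdOrthonormalBasis]
    have := φ.contDiff_two.continuous_iteratedFDeriv (m := 2) le_rfl
    fun_prop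
  have hsupp : HasCompactSupport (Δ φ.toFun) := by
    rw [InnerProductSpace.laplacian_eq_iteratedFDeriv_stdOrthonormalBasis]
    have h : HasCompactSupport φ.toFun := TestFunction.hasCompactSupport' φ
    refine (h.iteratedFDeriv (𝕜 := ℝ) 2).mono fun x hx => ?_
    rw [Function.mem_support] at hx ⊢
    contrapose! hx
    simp [hx]
  exact (hcont.memLp_of_hasCompactSupport hsupp).restrict _

/-- The linear map `φ ↦ Δφ` from `C_c^∞(Ω)` to `L²(Ω)`. -/
def SmoothCompact.laplacianLp (Ω : Opens (EuclideanSpace ℝ (Fin N))) :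
    SmoothCompact Ω →ₗ[ℝ] Lp ℝ 2 (volume.restrict (Ω : Set (EuclideanSpace ℝ (Fin N)))) where
  toFun φ := φ.memLp_laplacian.toLp _
  map_add' φ ψ := by
    rw [← MemLp.toLp_add]
    refine MemLp.toLp_congr _ _ (Filter.Eventually.of_forall fun x => ?_)
    exact φ.contDiff_two.contDiffAt.laplacian_add ψ.contDiff_two.contDiffAt
  map_smul' c φ := by
    rw [RingHom.id_apply, ← MemLp.toLp_const_smul]
    refine MemLp.toLp_congr _ _ (Filter.Eventually.of_forall fun x => ?_)
    exact InnerProductSpace.laplacian_smul c φ.contDiff_two.contDiffAt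

/-- `C_c^∞(Ω)` is (semi)normed by `φ ↦ ‖Δφ‖_{L²(Ω)}`. -/
instance : SeminormedAddCommGroup (SmoothCompact Ω) :=
  SeminormedAddCommGroup.induced _ _ (SmoothCompact.laplacianLp Ω)

instance : NormedSpace ℝ (SmoothCompact Ω) :=
  NormedSpace.induced ℝ _ _ (SmoothCompact.laplacianLp Ω)

theorem SmoothCompact.norm_eq (φ : SmoothCompact Ω) :
    ‖φ‖ = Real.sqrt (∫ x in (Ω : Set (EuclideanSpace ℝ (Fin N))), |Δ φ.toFun x| ^ 2) := by
  change ‖φ.memLp_laplacian.toLp _‖ = _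
  rw [Lp.norm_toLp, φ.memLp_laplacian.eLpNorm_eq_integral_rpow_norm (by norm_num) (by norm_num),
    ENNReal.toReal_ofReal (by positivity), Real.sqrt_eq_rpow]
  norm_num

/-- The Beppo-Levi space `D^{2,2}_0(Ω)`: the completion of `C_c^∞(Ω)` with respect to
`‖Δφ‖_{L²(Ω)}`. -/
abbrev BeppoLevi (Ω : Opens (EuclideanSpace ℝ (Fin N))) : Type :=
  UniformSpace.Completion (SmoothCompact Ω)

end BeppoLevi

end

/-! ### Second derivatives and the Laplacian -/

section SecondDerivatives

open scoped LineDeriv SchwartzMap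

variable {E ι : Type*} [NormedAddCommGroup E] [InnerProductSpace ℝ E]

/-! The embedding comes from a pointwise bound of a test function by a potential of order two of its
Hessian, followed by a rearrangement estimate for that potential.

Two integrations by parts along a ray give `φ(x) = ∫₀^∞ r D²φ(x + rz)(z, z) dr`. Averaging over the
unit ball in `z` bounds `|φ|` by a multiple of the potential of `F = |D²φ|`. For an indicator `1_A`,
the integral of the potential over a set `S` is at most a constant times `min(|S| |A|^a, |A| |S|^a)`
with `a = 2/N`. The layer-cake formula for `F` then bounds the mean of `|φ|` over `S` by a multiple
of `h(|S|)`, where `h(t) = ∫₀^∞ min(α(s)^a, α(s) t^(a-1)) ds` and `α` is the distribution function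
of `F`. Taking `S = {|φ| > v}` gives `φ^*(t) ≤ c h(t)`.

Since `1/2^{**} - 1/2 = -a`, the Lorentz quasi-norm is the `L²` norm of `t^(-a) φ^*(t)`. Now `t^(-a)
h(t)` is dominated by an integral operator acting on `F^*`, whose kernel is homogeneous of degree
`-1`. The Schur test with weight `t^(-1/2)` makes this operator bounded on `L²(0, ∞)` exactly in the
range `a < 1/2`, that is `N > 4`, and `‖F^*‖₂ ≤ ‖F‖₂`. For `φ^{**}` a Hardy inequality, again by the
Schur test, is added. Finally `‖D²φ‖₂ ≤ N² ‖Δφ‖₂` by integration by parts.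

To reach the completion, two Sobolev inequalities extend the inclusion of test functions to a map
`S` into `L^{2^{**}}(Ω)`. It is injective because the extended Laplacian is an isometry into `L²`
and is the weak Laplacian of `S u`. The Lorentz bounds survive the limit by Fatou's lemma, applied
both to `|φ_n|` on a superlevel set of the limit and to the majorants `h_n`. -/

theorem ContinuousLinearMap.opNorm_le_sum_orthonormalBasis [Fintype ι] {F : Type*}
    [NormedAddCommGroup F] [NormedSpace ℝ F] (b : OrthonormalBasis ι ℝ E) (L : E →L[ℝ] F) :
    ‖L‖ ≤ ∑ i, ‖L (b i)‖ := by
  refine L.opNorm_le_bound (Finset.sum_nonneg fun i _ => norm_nonneg _) fun v => ?_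
  conv_lhs => rw [← b.sum_repr v, map_sum]
  rw [Finset.sum_mul]
  refine (norm_sum_le _ _).trans (Finset.sum_le_sum fun i _ => ?_)
  rw [map_smul, norm_smul, mul_comm]
  gcongr
  rw [b.repr_apply_apply]
  simpa [b.orthonormal.1 i] using norm_inner_le_norm (𝕜 := ℝ) (b i) v

theorem ContinuousLinearMap.opNorm_le_sum_sum_orthonormalBasis [Fintype ι]
    (b : OrthonormalBasis ι ℝ E) (T : E →L[ℝ] E →L[ℝ] ℝ) :
    ‖T‖ ≤ ∑ i, ∑ j, ‖T (b i) (b j)‖ :=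
  (opNorm_le_sum_orthonormalBasis b T).trans
    (Finset.sum_le_sum fun i _ => opNorm_le_sum_orthonormalBasis b (T (b i)))

theorem SchwartzMap.lineDerivOp_lineDerivOp_apply (f : 𝓢(E, ℝ)) (v w x : E) :
    (∂_{v} (∂_{w} f) : 𝓢(E, ℝ)) x = fderiv ℝ (fderiv ℝ f) x v w := by
  have h := SchwartzMap.iteratedLineDerivOp_eq_iteratedFDeriv (m := ![v, w]) (f := f) (x := x)
  rw [iteratedFDeriv_two_apply] at h
  simpa [LineDeriv.iteratedLineDerivOp_succ_left] using h

theorem SchwartzMap.lineDerivOp_comm (f : 𝓢(E, ℝ)) (v w : E) :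
    (∂_{v} (∂_{w} f) : 𝓢(E, ℝ)) = ∂_{w} (∂_{v} f) := by
  ext x
  rw [f.lineDerivOp_lineDerivOp_apply, f.lineDerivOp_lineDerivOp_apply]
  exact ((f.smooth 2).contDiffAt.isSymmSndFDerivAt (by simp)) v w

variable [FiniteDimensional ℝ E] [MeasurableSpace E] [BorelSpace E]

theorem SchwartzMap.integrable_mul (f g : 𝓢(E, ℝ)) : Integrable (fun x => f x * g x) :=
  (SchwartzMap.pairing (ContinuousLinearMap.mul ℝ ℝ) f g).integrable

/-- One derivative in each of the two directions changes factor; the derivatives commute and the two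
signs cancel. -/
theorem SchwartzMap.integral_lineDerivOp_mul_self (f : 𝓢(E, ℝ)) (v w : E) :
    ∫ x, (∂_{v} (∂_{w} f) : 𝓢(E, ℝ)) x * (∂_{v} (∂_{w} f) : 𝓢(E, ℝ)) x
      = ∫ x, (∂_{v} (∂_{v} f) : 𝓢(E, ℝ)) x * (∂_{w} (∂_{w} f) : 𝓢(E, ℝ)) x := by
  rw [SchwartzMap.integral_mul_lineDerivOp_right_eq_neg_left, f.lineDerivOp_comm v w,
    SchwartzMap.lineDerivOp_comm _ v w, ← SchwartzMap.integral_mul_lineDerivOp_right_eq_neg_left]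

/-- After the integration by parts, the double sum is the expansion of the square of `∑ i, ∂ᵢ∂ᵢ f`.
In particular each single mixed derivative is controlled by the Laplacian in `L²`. -/
theorem SchwartzMap.sum_integral_lineDerivOp_sq [Fintype ι] (b : OrthonormalBasis ι ℝ E)
    (f : 𝓢(E, ℝ)) :
    ∑ i, ∑ j, ∫ x, ((∂_{b i} (∂_{b j} f) : 𝓢(E, ℝ)) x) ^ 2 = ∫ x, ((Δ f : 𝓢(E, ℝ)) x) ^ 2 := by
  have h i j : ∫ x, ((∂_{b i} (∂_{b j} f) : 𝓢(E, ℝ)) x) ^ 2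
      = ∫ x, (∂_{b i} (∂_{b i} f) : 𝓢(E, ℝ)) x * (∂_{b j} (∂_{b j} f) : 𝓢(E, ℝ)) x := by
    rw [← SchwartzMap.integral_lineDerivOp_mul_self]
    simp_rw [pow_two]
  simp_rw [h]
  rw [SchwartzMap.laplacian_eq_sum b f]
  simp_rw [_root_.sum_apply, pow_two, Finset.sum_mul_sum]
  rw [integral_finsetSum _ fun i _ => integrable_finsetSum _ fun j _ => integrable_mul _ _]
  refine Finset.sum_congr rfl fun i _ => ?_
  rw [integral_finsetSum _ fun j _ => integrable_mul _ _]

theorem SchwartzMap.eLpNorm_lineDerivOp_le [Fintype ι] (b : OrthonormalBasis ι ℝ E)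
    (f : 𝓢(E, ℝ)) (i j : ι) :
    eLpNorm (∂_{b i} (∂_{b j} f) : 𝓢(E, ℝ)) 2 volume ≤ eLpNorm (Δ f : 𝓢(E, ℝ)) 2 volume := by
  rw [((∂_{b i} (∂_{b j} f) : 𝓢(E, ℝ)).memLp 2 volume).eLpNorm_eq_integral_rpow_norm
      (by norm_num) (by norm_num),
    ((Δ f : 𝓢(E, ℝ)).memLp 2 volume).eLpNorm_eq_integral_rpow_norm (by norm_num) (by norm_num)]
  refine ENNReal.ofReal_le_ofReal ?_
  refine Real.rpow_le_rpow (by positivity) ?_ (by norm_num)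
  simp only [ENNReal.toReal_ofNat, Real.rpow_ofNat, Real.norm_eq_abs, sq_abs]
  rw [← f.sum_integral_lineDerivOp_sq b]
  refine le_trans ?_ (Finset.single_le_sum (f := fun i => ∑ j,
    ∫ x, ((∂_{b i} (∂_{b j} f) : 𝓢(E, ℝ)) x) ^ 2) ?_ (Finset.mem_univ i))
  · exact Finset.single_le_sum (f := fun j => ∫ x, ((∂_{b i} (∂_{b j} f) : 𝓢(E, ℝ)) x) ^ 2)
      (fun _ _ => integral_nonneg fun _ => sq_nonneg _) (Finset.mem_univ j)
  · exact fun _ _ => Finset.sum_nonneg fun _ _ => integral_nonneg fun _ => sq_nonneg _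

theorem SchwartzMap.eLpNorm_fderiv_fderiv_le [Fintype ι] (b : OrthonormalBasis ι ℝ E)
    (g : 𝓢(E, ℝ)) :
    eLpNorm (fderiv ℝ (fderiv ℝ g)) 2 volume
      ≤ (Fintype.card ι : ℝ≥0∞) ^ 2 * eLpNorm (Δ g : 𝓢(E, ℝ)) 2 volume := by
  have hm i j : AEStronglyMeasurable (fun x => ‖(∂_{b i} (∂_{b j} g) : 𝓢(E, ℝ)) x‖) volume :=
    (SchwartzMap.continuous _).norm.aestronglyMeasurable
  have h1 : eLpNorm (fderiv ℝ (fderiv ℝ g)) 2 volume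
      ≤ eLpNorm (∑ i, ∑ j, fun x => ‖(∂_{b i} (∂_{b j} g) : 𝓢(E, ℝ)) x‖) 2 volume := by
    refine eLpNorm_mono_real (F := E →L[ℝ] E →L[ℝ] ℝ) fun x => ?_
    simp only [Finset.sum_apply, SchwartzMap.lineDerivOp_lineDerivOp_apply]
    exact ContinuousLinearMap.opNorm_le_sum_sum_orthonormalBasis b _
  have h2 : eLpNorm (∑ i, ∑ j, fun x => ‖(∂_{b i} (∂_{b j} g) : 𝓢(E, ℝ)) x‖) 2 volume
      ≤ ∑ i, ∑ j, eLpNorm (fun x => ‖(∂_{b i} (∂_{b j} g) : 𝓢(E, ℝ)) x‖) 2 volume := by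
    refine (eLpNorm_sum_le (fun i _ => ?_) (by norm_num)).trans
      (Finset.sum_le_sum fun i _ => eLpNorm_sum_le (fun j _ => hm i j) (by norm_num))
    exact Finset.aestronglyMeasurable_sum _ fun j _ => hm i j
  refine h1.trans (h2.trans ?_)
  have h3 i j : eLpNorm (fun x => ‖(∂_{b i} (∂_{b j} g) : 𝓢(E, ℝ)) x‖) 2 volume
      ≤ eLpNorm (Δ g : 𝓢(E, ℝ)) 2 volume := by
    rw [eLpNorm_norm]
    exact g.eLpNorm_lineDerivOp_le b i j
  refine (Finset.sum_le_sum fun i _ => Finset.sum_le_sum fun j _ => h3 i j).trans_eq ?_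
  simp [pow_two, mul_assoc]

theorem eLpNorm_fderiv_fderiv_le_laplacian {f : E → ℝ} (hf : ContDiff ℝ (⊤ : ℕ∞) f)
    (hc : HasCompactSupport f) :
    eLpNorm (fderiv ℝ (fderiv ℝ f)) 2 volume
      ≤ ((Module.finrank ℝ E : ℝ≥0∞)) ^ 2 * eLpNorm (Δ f) 2 volume := by
  obtain ⟨g, rfl⟩ : ∃ g : 𝓢(E, ℝ), ⇑g = f := ⟨hc.toSchwartzMap hf, rfl⟩
  have h := g.eLpNorm_fderiv_fderiv_le (stdOrthonormalBasis ℝ E)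
  rwa [show ⇑(Δ g : 𝓢(E, ℝ)) = Δ ⇑g from funext fun x => g.laplacian_apply x,
    Fintype.card_fin] at h

theorem integral_laplacian_mul {f g : E → ℝ} (hf : ContDiff ℝ (⊤ : ℕ∞) f)
    (hcf : HasCompactSupport f) (hg : ContDiff ℝ (⊤ : ℕ∞) g) (hcg : HasCompactSupport g) :
    ∫ x, Δ f x * g x = ∫ x, f x * Δ g x := by
  have h := SchwartzMap.integral_mul_laplacian_right_eq_left (μ := volume)
    (hcf.toSchwartzMap hf) (hcg.toSchwartzMap hg)
  simp_rw [SchwartzMap.laplacian_apply] at h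
  exact h.symm

end SecondDerivatives

/-! ### Power weights and the Schur test -/

section SchurTest

theorem volume_setOf_pos_ofReal_lt (m : ℝ≥0∞) :
    volume {s : ℝ | 0 < s ∧ ENNReal.ofReal s < m} = m := by
  rcases eq_or_ne m ∞ with rfl | hm
  · have : {s : ℝ | 0 < s ∧ ENNReal.ofReal s < ∞} = Ioi 0 := by ext s; simp
    rw [this, Real.volume_Ioi]
  · have : {s : ℝ | 0 < s ∧ ENNReal.ofReal s < m} = Ioo 0 m.toReal := by
      ext s
      simp only [mem_ofPred_eq, mem_Ioo, and_congr_right_iff]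
      exact fun hs => ENNReal.ofReal_lt_iff_lt_toReal hs.le hm
    rw [this, Real.volume_Ioo, sub_zero, ENNReal.ofReal_toReal hm]

/-- The layer-cake formula for a single value. It serves both for values of a function and for
measures of its superlevel sets. -/
theorem lintegral_Ioi_indicator_ofReal_lt (m : ℝ≥0∞) :
    ∫⁻ s in Ioi (0 : ℝ), {s : ℝ | ENNReal.ofReal s < m}.indicator 1 s = m := by
  have hm : MeasurableSet {s : ℝ | ENNReal.ofReal s < m} :=
    measurableSet_lt ENNReal.measurable_ofReal measurable_const
  rw [lintegral_indicator_one hm, Measure.restrict_apply hm, inter_comm]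
  exact volume_setOf_pos_ofReal_lt m

theorem lintegral_Ioc_rpow {p c : ℝ} (hp : -1 < p) (hc : 0 ≤ c) :
    ∫⁻ t in Ioc 0 c, ENNReal.ofReal (t ^ p) = ENNReal.ofReal (c ^ (p + 1) / (p + 1)) := by
  rw [← ofReal_integral_eq_lintegral_ofReal, ← intervalIntegral.integral_of_le hc,
    integral_rpow (Or.inl hp), Real.zero_rpow (by linarith), sub_zero]
  · exact (intervalIntegrable_iff_integrableOn_Ioc_of_le hc).1
      (intervalIntegral.intervalIntegrable_rpow' hp)
  · exact (ae_restrict_iff' measurableSet_Ioc).2 (.of_forall fun t ht => Real.rpow_nonneg ht.1.le _)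

theorem lintegral_Ioi_rpow {p c : ℝ} (hp : p < -1) (hc : 0 < c) :
    ∫⁻ t in Ioi c, ENNReal.ofReal (t ^ p) = ENNReal.ofReal (-c ^ (p + 1) / (p + 1)) := by
  rw [← ofReal_integral_eq_lintegral_ofReal, integral_Ioi_rpow_of_lt hp hc]
  · exact integrableOn_Ioi_rpow_of_lt hp hc
  · exact (ae_restrict_iff' measurableSet_Ioi).2
      (.of_forall fun t ht => Real.rpow_nonneg (hc.trans ht).le _)

theorem lintegral_mul_sq_le {α : Type*} [MeasurableSpace α] {μ : Measure α} {f g : α → ℝ≥0∞}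
    (hf : AEMeasurable f μ) (hg : AEMeasurable g μ) :
    (∫⁻ x, f x * g x ∂μ) ^ 2 ≤ (∫⁻ x, f x ^ 2 ∂μ) * ∫⁻ x, g x ^ 2 ∂μ := by
  have h := ENNReal.lintegral_mul_le_Lp_mul_Lq μ Real.HolderConjugate.two_two hf hg
  calc
    (∫⁻ x, f x * g x ∂μ) ^ 2
      ≤ ((∫⁻ x, f x ^ (2 : ℝ) ∂μ) ^ (1 / 2 : ℝ) * (∫⁻ x, g x ^ (2 : ℝ) ∂μ) ^ (1 / 2 : ℝ)) ^ 2 := by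
        gcongr
        exact h
    _ = _ := by
        simp_rw [mul_pow, ← ENNReal.rpow_natCast, ← ENNReal.rpow_mul]
        norm_num

/-- The Schur test. Cauchy–Schwarz is applied to the splitting `K f = (K w)^(1/2) (K f² / w)^(1/2)`;
`hA` absorbs the first factor, and after Tonelli `hB` absorbs the second. -/
theorem lintegral_sq_lintegral_mul_le {α β : Type*} [MeasurableSpace α] [MeasurableSpace β]
    {μ : Measure α} {ν : Measure β} [SFinite μ] [SFinite ν] {K : α → β → ℝ≥0∞} {u : α → ℝ≥0∞}
    {w : β → ℝ≥0∞} {A B : ℝ≥0∞} {f : β → ℝ≥0∞} (hK : Measurable (Function.uncurry K))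
    (hu : Measurable u) (hw : Measurable w) (hf : Measurable f)
    (hw0 : ∀ᵐ y ∂ν, w y ≠ 0) (hwt : ∀ᵐ y ∂ν, w y ≠ ∞)
    (hA : ∀ᵐ x ∂μ, ∫⁻ y, K x y * w y ∂ν ≤ A * u x)
    (hB : ∀ᵐ y ∂ν, ∫⁻ x, K x y * u x ∂μ ≤ B * w y) :
    ∫⁻ x, (∫⁻ y, K x y * f y ∂ν) ^ 2 ∂μ ≤ A * B * ∫⁻ y, f y ^ 2 ∂ν := by
  have hKx x : Measurable (K x) := hK.comp measurable_prodMk_left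
  have hsq : ∀ᵐ x ∂μ, (∫⁻ y, K x y * f y ∂ν) ^ 2
      ≤ A * ∫⁻ y, u x * (K x y * (f y ^ 2 / w y)) ∂ν := by
    filter_upwards [hA] with x hx
    have hm := hKx x
    have h1 : ∫⁻ y, K x y * f y ∂ν
        = ∫⁻ y, (K x y * w y) ^ (1 / 2 : ℝ) * (K x y * (f y ^ 2 / w y)) ^ (1 / 2 : ℝ) ∂ν := by
      refine lintegral_congr_ae ?_
      filter_upwards [hw0, hwt] with y h0 ht
      rw [← ENNReal.mul_rpow_of_nonneg _ _ (by norm_num : (0 : ℝ) ≤ 1 / 2)]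
      have : K x y * w y * (K x y * (f y ^ 2 / w y)) = (K x y * f y) ^ 2 := by
        calc K x y * w y * (K x y * (f y ^ 2 / w y))
            = K x y ^ 2 * (w y * (f y ^ 2 / w y)) := by ring
          _ = _ := by rw [ENNReal.mul_div_cancel h0 ht, mul_pow]
      rw [this, ← ENNReal.rpow_natCast, ← ENNReal.rpow_mul]
      norm_num
    rw [h1]
    refine (lintegral_mul_sq_le (by fun_prop) (by fun_prop)).trans ?_
    simp_rw [← ENNReal.rpow_natCast, ← ENNReal.rpow_mul]
    norm_num
    rw [lintegral_const_mul _ (by fun_prop), ← mul_assoc]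
    gcongr
  calc
    ∫⁻ x, (∫⁻ y, K x y * f y ∂ν) ^ 2 ∂μ
      ≤ ∫⁻ x, A * ∫⁻ y, u x * (K x y * (f y ^ 2 / w y)) ∂ν ∂μ := lintegral_mono_ae hsq
    _ = A * ∫⁻ y, ∫⁻ x, u x * (K x y * (f y ^ 2 / w y)) ∂μ ∂ν := by
        rw [lintegral_const_mul, lintegral_lintegral_swap]
        · exact Measurable.aemeasurable
            ((hu.comp measurable_fst).mul (hK.mul (((hf.pow_const 2).div hw).comp measurable_snd)))
        · exact Measurable.lintegral_prod_right'
            (f := fun p : α × β => u p.1 * (K p.1 p.2 * (f p.2 ^ 2 / w p.2)))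
            ((hu.comp measurable_fst).mul (hK.mul (((hf.pow_const 2).div hw).comp measurable_snd)))
    _ ≤ A * ∫⁻ y, B * f y ^ 2 ∂ν := by
        gcongr A * ?_
        refine lintegral_mono_ae ?_
        filter_upwards [hB, hw0, hwt] with y hy h0 ht
        calc
          ∫⁻ x, u x * (K x y * (f y ^ 2 / w y)) ∂μ
            = ∫⁻ x, (K x y * u x) * (f y ^ 2 / w y) ∂μ := by
              refine lintegral_congr fun x => ?_
              ring
          _ = (∫⁻ x, K x y * u x ∂μ) * (f y ^ 2 / w y) :=
              lintegral_mul_const _ ((hK.comp measurable_prodMk_right).mul hu)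
          _ ≤ B * w y * (f y ^ 2 / w y) := by gcongr
          _ = B * f y ^ 2 := by rw [mul_assoc, ENNReal.mul_div_cancel h0 ht]
    _ = A * B * ∫⁻ y, f y ^ 2 ∂ν := by rw [lintegral_const_mul _ (by fun_prop), mul_assoc]

end SchurTest

/-! ### Hardy type inequalities -/

section Hardy

theorem lintegral_Ioc_mul_rpow {p c x : ℝ} (hp : -1 < p) (hc : 0 ≤ c) (hx : 0 ≤ x) :
    ∫⁻ t in Ioc 0 x, ENNReal.ofReal (c * t ^ p) = ENNReal.ofReal (c * (x ^ (p + 1) / (p + 1))) := by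
  simp_rw [ENNReal.ofReal_mul hc]
  rw [lintegral_const_mul _ (by fun_prop), lintegral_Ioc_rpow hp hx]

theorem lintegral_Ioi_mul_rpow {p c x : ℝ} (hp : p < -1) (hc : 0 ≤ c) (hx : 0 < x) :
    ∫⁻ t in Ioi x, ENNReal.ofReal (c * t ^ p)
      = ENNReal.ofReal (c * (x ^ (p + 1) / (-(p + 1)))) := by
  simp_rw [ENNReal.ofReal_mul hc]
  rw [lintegral_const_mul _ (by fun_prop), lintegral_Ioi_rpow hp hx, neg_div, div_neg]

theorem lintegral_Ioi_le_of_le_rpow {f : ℝ → ℝ≥0∞} {x p q b c : ℝ} (hx : 0 < x) (hp : -1 < p)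
    (hq : q < -1) (hb : 0 ≤ b) (hc : 0 ≤ c)
    (h1 : ∀ t ∈ Ioc 0 x, f t ≤ ENNReal.ofReal (b * t ^ p))
    (h2 : ∀ t ∈ Ioi x, f t ≤ ENNReal.ofReal (c * t ^ q)) :
    ∫⁻ t in Ioi 0, f t
      ≤ ENNReal.ofReal (b * (x ^ (p + 1) / (p + 1)) + c * (x ^ (q + 1) / (-(q + 1)))) := by
  rw [← Ioc_union_Ioi_eq_Ioi hx.le, lintegral_union measurableSet_Ioi
    (Ioc_disjoint_Ioi le_rfl), ENNReal.ofReal_add]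
  · rw [← lintegral_Ioc_mul_rpow hp hb hx.le, ← lintegral_Ioi_mul_rpow hq hc hx]
    exact add_le_add (setLIntegral_mono' measurableSet_Ioc h1)
      (setLIntegral_mono' measurableSet_Ioi h2)
  · exact mul_nonneg hb (div_nonneg (Real.rpow_nonneg hx.le _) (by linarith))
  · exact mul_nonneg hc (div_nonneg (Real.rpow_nonneg hx.le _) (by linarith))

theorem ae_Ioi_ofReal_rpow_ne_zero (p : ℝ) :
    ∀ᵐ t ∂volume.restrict (Ioi (0 : ℝ)), ENNReal.ofReal (t ^ p) ≠ 0 :=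
  (ae_restrict_iff' measurableSet_Ioi).2 <| .of_forall fun t ht => by
    simpa using Real.rpow_pos_of_pos ht p

/-- The kernel `t^{-a-1} τ^a 1_{τ < t}` of the averaging operator. -/
noncomputable def averagingKernel (a t τ : ℝ) : ℝ≥0∞ :=
  if τ < t then ENNReal.ofReal (t ^ (-a - 1) * τ ^ a) else 0

theorem measurable_averagingKernel (a : ℝ) : Measurable (Function.uncurry (averagingKernel a)) := by
  unfold averagingKernel Function.uncurry
  refine Measurable.ite (measurableSet_lt measurable_snd measurable_fst) ?_ measurable_const
  fun_prop

/-- The kernel is homogeneous of degree `-1`, so `t^(-1/2)` is a Schur weight on both sides. Both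
one-variable integrals equal `1 / (a + 1/2)` times the weight. -/
theorem lintegral_averagingKernel_sq_le {a : ℝ} (ha : 0 < a) {f : ℝ → ℝ≥0∞} (hf : Measurable f) :
    ∫⁻ t in Ioi 0, (∫⁻ τ in Ioi 0, averagingKernel a t τ * f τ) ^ 2
      ≤ ENNReal.ofReal (1 / (a + 1 / 2)) * ENNReal.ofReal (1 / (a + 1 / 2))
        * ∫⁻ t in Ioi 0, f t ^ 2 := by
  have ha' : 0 ≤ 1 / (a + 1 / 2) := by positivity
  refine lintegral_sq_lintegral_mul_le (u := fun t => ENNReal.ofReal (t ^ (-(1 / 2) : ℝ)))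
    (w := fun t => ENNReal.ofReal (t ^ (-(1 / 2) : ℝ))) (measurable_averagingKernel a)
    (by fun_prop) (by fun_prop) hf (ae_Ioi_ofReal_rpow_ne_zero _)
    (.of_forall fun _ => ENNReal.ofReal_ne_top) ?_ ?_
  · refine (ae_restrict_iff' measurableSet_Ioi).2 (.of_forall fun t (ht : 0 < t) => ?_)
    rw [← ENNReal.ofReal_mul ha']
    refine (lintegral_Ioi_le_of_le_rpow (b := t ^ (-a - 1)) (c := 0) (p := a - 1 / 2)
      (q := -2) ht (by linarith) (by norm_num) (by positivity) le_rfl ?_ ?_).trans_eq ?_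
    · intro τ hτ
      unfold averagingKernel
      split_ifs
      · rw [← ENNReal.ofReal_mul (mul_nonneg (by positivity) (Real.rpow_nonneg hτ.1.le _)),
          mul_assoc, ← Real.rpow_add hτ.1, ← sub_eq_add_neg]
      · simp
    · intro τ hτ
      simp [averagingKernel, not_lt.2 (mem_Ioi.1 hτ).le]
    · congr 1
      have : t ^ (-a - 1) * t ^ (a - 1 / 2 + 1) = t ^ (-(1 / 2) : ℝ) := by
        rw [← Real.rpow_add ht]; congr 1; ring
      rw [← mul_div_assoc, this, show a - 1 / 2 + 1 = a + 1 / 2 by ring]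
      ring
  · refine (ae_restrict_iff' measurableSet_Ioi).2 (.of_forall fun τ (hτ : 0 < τ) => ?_)
    rw [← ENNReal.ofReal_mul ha']
    refine (lintegral_Ioi_le_of_le_rpow (b := 0) (c := τ ^ a) (p := 0)
      (q := -a - 3 / 2) hτ (by linarith) (by linarith) le_rfl (by positivity) ?_ ?_).trans_eq ?_
    · intro t ht
      simp [averagingKernel, not_lt.2 ht.2]
    · intro t ht
      have ht0 : 0 < t := hτ.trans ht
      rw [averagingKernel, if_pos (mem_Ioi.1 ht), ← ENNReal.ofReal_mul (by positivity),
        mul_right_comm, ← Real.rpow_add ht0, mul_comm]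
      apply le_of_eq; congr 3; ring
    · congr 1
      have : τ ^ a * τ ^ (-a - 3 / 2 + 1) = τ ^ (-(1 / 2) : ℝ) := by
        rw [← Real.rpow_add hτ]; congr 1; ring
      rw [← mul_div_assoc (τ ^ a), this,
        show -(-a - 3 / 2 + 1) = a + 1 / 2 by ring]
      ring

/-- The kernel `t^{-a} min (t^{a-1}, τ^{a-1})`. -/
noncomputable def potentialKernel (a t τ : ℝ) : ℝ≥0∞ :=
  ENNReal.ofReal (t ^ (-a) * min (t ^ (a - 1)) (τ ^ (a - 1)))

theorem measurable_potentialKernel (a : ℝ) : Measurable (Function.uncurry (potentialKernel a)) := by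
  unfold potentialKernel Function.uncurry
  fun_prop

/-- Schur test with `t^(-1/2)` again. Splitting at the diagonal, the side where the integration
variable is smaller and the side where it is larger contribute `2` and `1 / (1/2 - a)`, in one order
or the other; `a < 1/2` is what makes the latter integral converge. -/
theorem lintegral_potentialKernel_sq_le {a : ℝ} (ha2 : a < 1 / 2) {f : ℝ → ℝ≥0∞}
    (hf : Measurable f) :
    ∫⁻ t in Ioi 0, (∫⁻ τ in Ioi 0, potentialKernel a t τ * f τ) ^ 2
      ≤ ENNReal.ofReal (2 + 1 / (1 / 2 - a)) * ENNReal.ofReal (2 + 1 / (1 / 2 - a))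
        * ∫⁻ t in Ioi 0, f t ^ 2 := by
  have ha3 : 0 < 1 / 2 - a := by linarith
  have ha' : 0 ≤ 2 + 1 / (1 / 2 - a) := by positivity
  refine lintegral_sq_lintegral_mul_le (u := fun t => ENNReal.ofReal (t ^ (-(1 / 2) : ℝ)))
    (w := fun t => ENNReal.ofReal (t ^ (-(1 / 2) : ℝ))) (measurable_potentialKernel a)
    (by fun_prop) (by fun_prop) hf (ae_Ioi_ofReal_rpow_ne_zero _)
    (.of_forall fun _ => ENNReal.ofReal_ne_top) ?_ ?_
  · refine (ae_restrict_iff' measurableSet_Ioi).2 (.of_forall fun t (ht : 0 < t) => ?_)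
    rw [← ENNReal.ofReal_mul ha']
    refine (lintegral_Ioi_le_of_le_rpow (b := t ^ (-1 : ℝ)) (c := t ^ (-a)) (p := -(1 / 2))
      (q := a - 3 / 2) ht (by norm_num) (by linarith) (by positivity) (by positivity)
      ?_ ?_).trans_eq ?_
    · intro τ hτ
      have h0 : 0 ≤ τ ^ (-(1 / 2) : ℝ) := Real.rpow_nonneg hτ.1.le _
      have h1 : 0 ≤ τ ^ (a - 1) := Real.rpow_nonneg hτ.1.le _
      rw [potentialKernel, ← ENNReal.ofReal_mul (by positivity)]
      refine ENNReal.ofReal_le_ofReal (mul_le_mul_of_nonneg_right ?_ h0)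
      calc t ^ (-a) * min (t ^ (a - 1)) (τ ^ (a - 1)) ≤ t ^ (-a) * t ^ (a - 1) := by
            gcongr; exact min_le_left _ _
        _ = t ^ (-1 : ℝ) := by rw [← Real.rpow_add ht]; congr 1; ring
    · intro τ hτ
      have hτ0 : 0 < τ := ht.trans hτ
      rw [potentialKernel, ← ENNReal.ofReal_mul (by positivity)]
      refine ENNReal.ofReal_le_ofReal ?_
      calc t ^ (-a) * min (t ^ (a - 1)) (τ ^ (a - 1)) * τ ^ (-(1 / 2) : ℝ)
          ≤ t ^ (-a) * τ ^ (a - 1) * τ ^ (-(1 / 2) : ℝ) := by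
            gcongr; exact min_le_right _ _
        _ = t ^ (-a) * τ ^ (a - 3 / 2) := by
            rw [mul_assoc, ← Real.rpow_add hτ0]; congr 2; ring
    · congr 1
      have h1 : t ^ (-1 : ℝ) * t ^ (-(1 / 2) + 1 : ℝ) = t ^ (-(1 / 2) : ℝ) := by
        rw [← Real.rpow_add ht]; congr 1; ring
      have h2 : t ^ (-a) * t ^ (a - 3 / 2 + 1) = t ^ (-(1 / 2) : ℝ) := by
        rw [← Real.rpow_add ht]; congr 1; ring
      rw [← mul_div_assoc, ← mul_div_assoc, h1, h2,
        show -(a - 3 / 2 + 1) = 1 / 2 - a by ring]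
      ring
  · refine (ae_restrict_iff' measurableSet_Ioi).2 (.of_forall fun τ (hτ : 0 < τ) => ?_)
    rw [← ENNReal.ofReal_mul ha']
    refine (lintegral_Ioi_le_of_le_rpow (b := τ ^ (a - 1)) (c := 1) (p := -a - 1 / 2)
      (q := -(3 / 2)) hτ (by linarith) (by norm_num) (by positivity) zero_le_one
      ?_ ?_).trans_eq ?_
    · intro t ht
      have ht0 : 0 < t := ht.1
      rw [potentialKernel, ← ENNReal.ofReal_mul (by positivity)]
      refine ENNReal.ofReal_le_ofReal ?_
      calc t ^ (-a) * min (t ^ (a - 1)) (τ ^ (a - 1)) * t ^ (-(1 / 2) : ℝ)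
          ≤ t ^ (-a) * τ ^ (a - 1) * t ^ (-(1 / 2) : ℝ) := by
            gcongr; exact min_le_right _ _
        _ = τ ^ (a - 1) * t ^ (-a - 1 / 2) := by
            rw [mul_right_comm, ← Real.rpow_add ht0, mul_comm]; congr 2
    · intro t ht
      have ht0 : 0 < t := hτ.trans ht
      rw [potentialKernel, ← ENNReal.ofReal_mul (by positivity)]
      refine ENNReal.ofReal_le_ofReal ?_
      calc t ^ (-a) * min (t ^ (a - 1)) (τ ^ (a - 1)) * t ^ (-(1 / 2) : ℝ)
          ≤ t ^ (-a) * t ^ (a - 1) * t ^ (-(1 / 2) : ℝ) := by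
            gcongr; exact min_le_left _ _
        _ = 1 * t ^ (-(3 / 2) : ℝ) := by
            rw [← Real.rpow_add ht0, ← Real.rpow_add ht0, one_mul]; congr 1; ring
    · congr 1
      have h1 : τ ^ (a - 1) * τ ^ (-a - 1 / 2 + 1) = τ ^ (-(1 / 2) : ℝ) := by
        rw [← Real.rpow_add hτ]; congr 1; ring
      rw [← mul_div_assoc, h1, show -a - 1 / 2 + 1 = 1 / 2 - a by ring,
        show (-(3 / 2) + 1 : ℝ) = -(1 / 2) by norm_num]
      ring

end Hardy

/-! ### Distribution functions and their majorants -/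

section Majorant

/-- The function `t ↦ ∫₀^∞ min (α(s)^a, α(s) t^{a-1}) ds` attached to a distribution function `α`,
which dominates the rearrangement of a potential. -/
noncomputable def potentialMajorant (a : ℝ) (α : ℝ → ℝ≥0∞) (t : ℝ) : ℝ≥0∞ :=
  ∫⁻ s in Ioi 0, min (α s ^ a) (α s * ENNReal.ofReal (t ^ (a - 1)))

theorem measurable_potentialMajorant (a : ℝ) {α : ℝ → ℝ≥0∞} (hα : Measurable α) :
    Measurable (potentialMajorant a α) := by
  refine Measurable.lintegral_prod_right'
    (f := fun p : ℝ × ℝ => min (α p.2 ^ a) (α p.2 * ENNReal.ofReal (p.1 ^ (a - 1)))) ?_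
  fun_prop

theorem potentialMajorant_anti {a : ℝ} (ha : a ≤ 1) (α : ℝ → ℝ≥0∞) {t t' : ℝ} (ht : 0 < t)
    (htt' : t ≤ t') : potentialMajorant a α t' ≤ potentialMajorant a α t := by
  unfold potentialMajorant
  refine lintegral_mono fun s => min_le_min_left _ (mul_le_mul' le_rfl (ENNReal.ofReal_le_ofReal ?_))
  exact Real.rpow_le_rpow_of_nonpos ht htt' (by linarith)

/-- With `k` the potential kernel, the left side is `m k(t, m)`. Since `k(t, ·)` is nonincreasing,
this is at most `∫₀^m k(t, τ) dτ`. -/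
theorem ofReal_rpow_mul_min_le_lintegral {a t : ℝ} (ha : a ≤ 1) (ht : 0 < t) {m : ℝ≥0∞}
    (hm : m ≠ ∞) :
    ENNReal.ofReal (t ^ (-a)) * min (m ^ a) (m * ENNReal.ofReal (t ^ (a - 1)))
      ≤ ∫⁻ τ in Ioi 0, potentialKernel a t τ * {τ | ENNReal.ofReal τ < m}.indicator 1 τ := by
  rcases eq_or_ne m 0 with rfl | h0
  · simp
  lift m to ℝ≥0 using hm
  have hm0 : 0 < (m : ℝ) := by simpa [pos_iff_ne_zero] using h0
  have hle : ENNReal.ofReal (t ^ (-a)) * min ((m : ℝ≥0∞) ^ a) (m * ENNReal.ofReal (t ^ (a - 1)))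
      = potentialKernel a t m * m := by
    have hma : (m : ℝ≥0∞) ^ a = m * ENNReal.ofReal ((m : ℝ) ^ (a - 1)) := by
      rw [← ENNReal.ofReal_rpow_of_pos hm0, ENNReal.ofReal_coe_nnreal]
      nth_rewrite 2 [← ENNReal.rpow_one (m : ℝ≥0∞)]
      rw [← ENNReal.rpow_add _ _ h0 ENNReal.coe_ne_top]
      congr 1; ring
    rw [potentialKernel, ENNReal.ofReal_mul (by positivity), mul_assoc, ENNReal.ofReal_min,
      mul_comm (min _ _), min_comm, hma]
    simp only [mul_min]
  rw [hle]
  conv_lhs => rw [← lintegral_Ioi_indicator_ofReal_lt (m : ℝ≥0∞)]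
  rw [← lintegral_const_mul _ (measurable_one.indicator
    (measurableSet_lt ENNReal.measurable_ofReal measurable_const))]
  refine setLIntegral_mono' measurableSet_Ioi fun τ (hτ : 0 < τ) => ?_
  by_cases h : ENNReal.ofReal τ < m
  · gcongr ?_ * _
    unfold potentialKernel
    gcongr 3
    refine Real.rpow_le_rpow_of_nonpos hτ ?_ (by linarith)
    rw [← ENNReal.ofReal_coe_nnreal] at h
    exact (ENNReal.lt_ofReal_iff_toReal_lt ENNReal.ofReal_ne_top).1 h |>.le.trans' (by
      rw [ENNReal.toReal_ofReal hτ.le])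
  · simp [h]

variable {X : Type*} [MeasurableSpace X] {μ : Measure X}

theorem antitone_measure_ofReal_lt (F : X → ℝ≥0∞) :
    Antitone fun s : ℝ => μ {y | ENNReal.ofReal s < F y} :=
  fun _ _ h => measure_mono fun _ hy => (ENNReal.ofReal_le_ofReal h).trans_lt hy

theorem measurableSet_ofReal_lt {Y : Type*} [MeasurableSpace Y] {g : Y → ℝ} {G : Y → ℝ≥0∞}
    (hg : Measurable g) (hG : Measurable G) : MeasurableSet {y | ENNReal.ofReal (g y) < G y} :=
  measurableSet_lt hg.ennreal_ofReal hG

/-- The inner integral over `s` is the decreasing rearrangement of `F` in layer-cake form. Expanding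
the square gives pairs `(s, s')`; integrating out `τ` leaves `min(α(s), α(s')) = α(max(s, s'))`, and
Tonelli over pairs and `y` reassembles `F²`. -/
theorem lintegral_sq_lintegral_indicator_le [SFinite μ] {F : X → ℝ≥0∞} (hF : Measurable F) :
    ∫⁻ τ in Ioi (0 : ℝ), (∫⁻ s in Ioi (0 : ℝ),
        {τ | ENNReal.ofReal τ < μ {y | ENNReal.ofReal s < F y}}.indicator 1 τ) ^ 2
      ≤ ∫⁻ y, F y ^ 2 ∂μ := by
  set α : ℝ → ℝ≥0∞ := fun s => μ {y | ENNReal.ofReal s < F y} with hα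
  have hαanti : Antitone α := antitone_measure_ofReal_lt F
  have hαm : Measurable α := hαanti.measurable
  set ν : Measure ℝ := volume.restrict (Ioi 0)
  have key (c d : ℝ≥0∞) (τ : ℝ) : ({τ : ℝ | ENNReal.ofReal τ < c}.indicator 1 τ : ℝ≥0∞)
      * {τ : ℝ | ENNReal.ofReal τ < d}.indicator 1 τ
      = {τ : ℝ | ENNReal.ofReal τ < min c d}.indicator 1 τ := by
    rw [← inter_indicator_mul]
    simp only [Pi.one_apply, mul_one]
    congr 1
    ext τ
    simp
  calc
    ∫⁻ τ, (∫⁻ s, {τ | ENNReal.ofReal τ < α s}.indicator 1 τ ∂ν) ^ 2 ∂ν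
      = ∫⁻ τ, ∫⁻ p, {τ | ENNReal.ofReal τ < min (α p.1) (α p.2)}.indicator 1 τ ∂(ν.prod ν) ∂ν := by
        refine lintegral_congr fun τ => ?_
        have hm : Measurable fun s => ({τ | ENNReal.ofReal τ < α s}.indicator 1 τ : ℝ≥0∞) :=
          measurable_one.indicator (measurableSet_ofReal_lt measurable_const hαm)
        rw [pow_two, ← lintegral_prod_mul hm.aemeasurable hm.aemeasurable]
        simp_rw [key]
    _ = ∫⁻ p, ∫⁻ τ, {τ | ENNReal.ofReal τ < min (α p.1) (α p.2)}.indicator 1 τ ∂ν ∂(ν.prod ν) := by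
        refine lintegral_lintegral_swap (Measurable.aemeasurable ?_)
        exact measurable_one.indicator (measurableSet_ofReal_lt measurable_fst
          ((hαm.comp (measurable_fst.comp measurable_snd)).min
            (hαm.comp (measurable_snd.comp measurable_snd))))
    _ = ∫⁻ p, μ {y | ENNReal.ofReal (max p.1 p.2) < F y} ∂(ν.prod ν) := by
        refine lintegral_congr fun p => ?_
        rw [lintegral_Ioi_indicator_ofReal_lt, ← hαanti.map_max]
    _ = ∫⁻ p, ∫⁻ y, {p : ℝ × ℝ | ENNReal.ofReal (max p.1 p.2) < F y}.indicator 1 p ∂μ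
          ∂(ν.prod ν) := by
        refine lintegral_congr fun p => ?_
        rw [← lintegral_indicator_one (measurableSet_ofReal_lt measurable_const hF)]
        rfl
    _ = ∫⁻ y, ∫⁻ p, {p : ℝ × ℝ | ENNReal.ofReal (max p.1 p.2) < F y}.indicator 1 p ∂(ν.prod ν)
          ∂μ := by
        refine lintegral_lintegral_swap (Measurable.aemeasurable ?_)
        exact measurable_one.indicator (measurableSet_ofReal_lt (by fun_prop)
          (hF.comp measurable_snd))
    _ ≤ ∫⁻ y, F y ^ 2 ∂μ := by
        refine le_of_eq (lintegral_congr fun y => ?_)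
        have hm : Measurable fun s : ℝ => ({s | ENNReal.ofReal s < F y}.indicator 1 s : ℝ≥0∞) :=
          measurable_one.indicator (measurableSet_ofReal_lt measurable_id measurable_const)
        have hp (p : ℝ × ℝ) :
            ({p : ℝ × ℝ | ENNReal.ofReal (max p.1 p.2) < F y}.indicator 1 p : ℝ≥0∞)
            = {s : ℝ | ENNReal.ofReal s < F y}.indicator 1 p.1
              * {s : ℝ | ENNReal.ofReal s < F y}.indicator 1 p.2 := by
          by_cases h1 : ENNReal.ofReal p.1 < F y <;> by_cases h2 : ENNReal.ofReal p.2 < F y <;>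
            simp [indicator, h1, h2]
        simp_rw [hp]
        rw [lintegral_prod_mul hm.aemeasurable hm.aemeasurable, lintegral_Ioi_indicator_ofReal_lt,
          pow_two]

/-- Integrating the pointwise kernel bound over the levels `s` dominates `t^(-a)` times the majorant
by the potential kernel acting on the rearrangement of `F`; the Schur bound and the `L²` bound for
the rearrangement finish. -/
theorem lintegral_potentialMajorant_sq_le [SFinite μ] {a : ℝ} (ha2 : a < 1 / 2) {F : X → ℝ≥0∞}
    (hF : Measurable F) (hfin : ∀ s : ℝ, 0 < s → μ {y | ENNReal.ofReal s < F y} ≠ ∞) :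
    ∫⁻ t in Ioi 0, (ENNReal.ofReal (t ^ (-a))
        * potentialMajorant a (fun s => μ {y | ENNReal.ofReal s < F y}) t) ^ 2
      ≤ ENNReal.ofReal (2 + 1 / (1 / 2 - a)) ^ 2 * ∫⁻ y, F y ^ 2 ∂μ := by
  set α : ℝ → ℝ≥0∞ := fun s => μ {y | ENNReal.ofReal s < F y} with hα
  have hαm : Measurable α := (antitone_measure_ofReal_lt F).measurable
  have hI : Measurable (Function.uncurry fun τ s : ℝ =>
      ({τ | ENNReal.ofReal τ < α s}.indicator 1 τ : ℝ≥0∞)) :=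
    measurable_one.indicator (measurableSet_ofReal_lt measurable_fst (hαm.comp measurable_snd))
  calc
    _ ≤ ∫⁻ t in Ioi 0, (∫⁻ τ in Ioi 0, potentialKernel a t τ
          * ∫⁻ s in Ioi 0, {τ | ENNReal.ofReal τ < α s}.indicator 1 τ) ^ 2 := by
        refine setLIntegral_mono' measurableSet_Ioi fun t (ht : 0 < t) => ?_
        gcongr
        have hk : Measurable fun τ => potentialKernel a t τ :=
          (measurable_potentialKernel a).comp measurable_prodMk_left
        rw [potentialMajorant, ← lintegral_const_mul _ (by fun_prop)]
        calc
          _ ≤ ∫⁻ s in Ioi 0, ∫⁻ τ in Ioi 0,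
                potentialKernel a t τ * {τ | ENNReal.ofReal τ < α s}.indicator 1 τ :=
              setLIntegral_mono' measurableSet_Ioi fun s (hs : 0 < s) =>
                ofReal_rpow_mul_min_le_lintegral (by linarith) ht (hfin s hs)
          _ = ∫⁻ τ in Ioi 0, ∫⁻ s in Ioi 0,
                potentialKernel a t τ * {τ | ENNReal.ofReal τ < α s}.indicator 1 τ := by
              refine lintegral_lintegral_swap (Measurable.aemeasurable ?_)
              exact (hk.comp measurable_snd).mul (hI.comp measurable_swap)
          _ = _ := by
              refine lintegral_congr fun τ => ?_
              exact lintegral_const_mul _ (hI.comp measurable_prodMk_left)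
    _ ≤ ENNReal.ofReal (2 + 1 / (1 / 2 - a)) * ENNReal.ofReal (2 + 1 / (1 / 2 - a))
          * ∫⁻ τ in Ioi 0, (∫⁻ s in Ioi 0, {τ | ENNReal.ofReal τ < α s}.indicator 1 τ) ^ 2 :=
        lintegral_potentialKernel_sq_le ha2 (Measurable.lintegral_prod_right' hI)
    _ ≤ _ := by
        rw [← pow_two]
        gcongr
        exact lintegral_sq_lintegral_indicator_le hF

end Majorant

/-! ### Potential estimates -/

section Potential

/-- The function `r g' - g` is a primitive of `r g''`, vanishes for large `r` and equals `-g(0)` at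
`0`. -/
theorem HasCompactSupport.enorm_le_lintegral_mul_deriv_deriv {g g' g'' : ℝ → ℝ}
    (hg : ∀ r, HasDerivAt g (g' r) r) (hg' : ∀ r, HasDerivAt g' (g'' r) r)
    (hg'' : Continuous g'') (hc : HasCompactSupport g) :
    ‖g 0‖ₑ ≤ ∫⁻ r in Ioi 0, ENNReal.ofReal r * ‖g'' r‖ₑ := by
  have hdg : deriv g = g' := funext fun r => (hg r).deriv
  have hdg' : deriv g' = g'' := funext fun r => (hg' r).deriv
  have hc' : HasCompactSupport g' := hdg ▸ hc.deriv
  have hh (r : ℝ) : HasDerivAt (fun r => r * g' r - g r) (r * g'' r) r := by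
    convert! ((hasDerivAt_id r).mul (hg' r)).sub (hg r) using 1
    simp
  have hdh : deriv (fun r => r * g' r - g r) = fun r => r * g'' r := funext fun r => (hh r).deriv
  have hC1 : ContDiff ℝ 1 (fun r => r * g' r - g r) := by
    rw [contDiff_one_iff_deriv, hdh]
    exact ⟨fun r => (hh r).differentiableAt, by fun_prop⟩
  have hcs : HasCompactSupport fun r => r * g' r - g r := (hc'.mul_left).sub hc
  have h := hcs.integral_Ioi_deriv_eq hC1 0
  rw [hdh] at h
  have h0 : g 0 = ∫ r in Ioi 0, r * g'' r := by rw [h]; ring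
  rw [h0]
  refine (enorm_integral_le_lintegral_enorm _).trans_eq ?_
  refine setLIntegral_congr_fun measurableSet_Ioi fun r (hr : 0 < r) => ?_
  rw [enorm_mul, Real.enorm_eq_ofReal hr.le]

variable {E : Type*} [NormedAddCommGroup E] [NormedSpace ℝ E]

theorem HasCompactSupport.enorm_le_lintegral_fderiv_fderiv {f : E → ℝ} (hf : ContDiff ℝ 2 f)
    (hc : HasCompactSupport f) (x : E) {z : E} (hz0 : z ≠ 0) (hz : ‖z‖ ≤ 1) :
    ‖f x‖ₑ ≤ ∫⁻ r in Ioi (0 : ℝ), ENNReal.ofReal r * ‖fderiv ℝ (fderiv ℝ f) (x + r • z)‖ₑ := by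
  have hf1 : ContDiff ℝ 1 (fderiv ℝ f) := hf.fderiv_right (by norm_num)
  have hline (r : ℝ) : HasDerivAt (fun r : ℝ => x + r • z) z r := by
    simpa using ((hasDerivAt_id r).smul_const z).const_add x
  -- A nondegenerate line is closed in `E`, so the restriction of `f` to it keeps compact support.
  have hemb : Topology.IsClosedEmbedding fun r : ℝ => x + r • z :=
    (Homeomorph.addLeft x).isClosedEmbedding.comp (isClosedEmbedding_smul_left hz0)
  have h1 (r : ℝ) : HasDerivAt (fun r : ℝ => f (x + r • z)) (fderiv ℝ f (x + r • z) z) r :=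
    ((hf.differentiable (by norm_num)) _).hasFDerivAt.comp_hasDerivAt r (hline r)
  have h2 (r : ℝ) : HasDerivAt (fun r : ℝ => fderiv ℝ f (x + r • z) z)
      (fderiv ℝ (fderiv ℝ f) (x + r • z) z z) r := by
    have h : HasDerivAt (fun r : ℝ => fderiv ℝ f (x + r • z))
        (fderiv ℝ (fderiv ℝ f) (x + r • z) z) r :=
      ((hf1.differentiable (by norm_num)) _).hasFDerivAt.comp_hasDerivAt r (hline r)
    simpa using h.clm_apply (hasDerivAt_const r z)
  have hcont : Continuous fun r : ℝ => fderiv ℝ (fderiv ℝ f) (x + r • z) z z := by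
    have := hf1.continuous_fderiv (by norm_num)
    fun_prop
  have h := HasCompactSupport.enorm_le_lintegral_mul_deriv_deriv h1 h2 hcont
    (hc.comp_isClosedEmbedding hemb)
  simp only [zero_smul, add_zero] at h
  refine h.trans (lintegral_mono fun r => ?_)
  gcongr
  rw [← ofReal_norm, ← ofReal_norm]
  refine ENNReal.ofReal_le_ofReal ?_
  calc _ ≤ ‖fderiv ℝ (fderiv ℝ f) (x + r • z)‖ * ‖z‖ * ‖z‖ :=
        ContinuousLinearMap.le_opNorm₂ _ _ _
    _ ≤ ‖fderiv ℝ (fderiv ℝ f) (x + r • z)‖ * 1 * 1 := by gcongr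
    _ = _ := by ring

variable [MeasurableSpace E]

/-- The potential `x ↦ ∫₀^∞ r ∫_{|z| < 1} F(x + r z) dz dr`, a multiple of the convolution of `F`
with `|x|^{2 - d}`, where `d` is the dimension. -/
noncomputable def ballPotential (μ : Measure E) (F : E → ℝ≥0∞) (x : E) : ℝ≥0∞ :=
  ∫⁻ r in Ioi (0 : ℝ), ENNReal.ofReal r * ∫⁻ z in Metric.ball 0 1, F (x + r • z) ∂μ

/-- The two bounds in the minimum balance, up to constants, at the radius `R = m^(1/d)`. The inner
part contributes `b R² / 2`; the outer part `m R^(2-d) / (d-2)` converges because `d > 2`. -/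
theorem lintegral_mul_min_rpow_le {b m : ℝ≥0∞} (hb : b ≠ ∞) {d : ℝ} (hd : 2 < d) :
    ∫⁻ r in Ioi (0 : ℝ), ENNReal.ofReal r * min b (ENNReal.ofReal (r ^ (-d)) * m)
      ≤ ENNReal.ofReal (b.toReal / 2 + 1 / (d - 2)) * m ^ (2 / d) := by
  have hK : 0 < b.toReal / 2 + 1 / (d - 2) := by
    have : 0 < 1 / (d - 2) := by apply one_div_pos.2; linarith
    positivity
  have hd2 : 0 < 2 / d := by positivity
  rcases eq_or_ne m ∞ with rfl | hm
  · rw [ENNReal.top_rpow_of_pos hd2, ENNReal.mul_top (by simpa using hK)]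
    exact le_top
  rcases eq_or_ne m 0 with rfl | hm0
  · simp
  lift m to ℝ≥0 using hm
  lift b to ℝ≥0 using hb
  have hmp : 0 < (m : ℝ) := by simpa [pos_iff_ne_zero] using hm0
  set R := (m : ℝ) ^ (1 / d) with hR
  have hRp : 0 < R := by positivity
  refine (lintegral_Ioi_le_of_le_rpow (x := R) (p := 1) (q := 1 - d) (b := b) (c := m) hRp
    (by norm_num) (by linarith) b.2 m.2 ?_ ?_).trans_eq ?_
  · intro r hr
    rw [ENNReal.ofReal_mul b.coe_nonneg, ENNReal.ofReal_coe_nnreal, Real.rpow_one, mul_comm]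
    gcongr
    exact min_le_left _ _
  · intro r hr
    have hr0 : 0 < r := hRp.trans hr
    calc
      _ ≤ ENNReal.ofReal r * (ENNReal.ofReal (r ^ (-d)) * m) := by gcongr; exact min_le_right _ _
      _ = _ := by
        rw [← ENNReal.ofReal_coe_nnreal (p := m), ← ENNReal.ofReal_mul (by positivity),
          ← ENNReal.ofReal_mul (by positivity)]
        congr 1
        rw [sub_eq_add_neg, Real.rpow_add hr0, Real.rpow_one]
        ring
  · have h1 : R ^ (1 + 1 : ℝ) = (m : ℝ) ^ (2 / d) := by
      rw [hR, ← Real.rpow_mul hmp.le]; congr 1; ring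
    have h2 : (m : ℝ) * R ^ (1 - d + 1) = (m : ℝ) ^ (2 / d) := by
      rw [hR, ← Real.rpow_mul hmp.le]
      nth_rewrite 1 [← Real.rpow_one (m : ℝ)]
      rw [← Real.rpow_add hmp]; congr 1; field_simp; ring
    rw [← ENNReal.ofReal_coe_nnreal (p := m), ENNReal.ofReal_rpow_of_pos hmp,
      ← ENNReal.ofReal_mul hK.le, ← mul_div_assoc (m : ℝ), h2, h1, ENNReal.coe_toReal]
    congr 1
    rw [show -(1 - d + 1) = d - 2 by ring]
    ring

variable [BorelSpace E] [FiniteDimensional ℝ E] {μ : Measure E} [μ.IsAddHaarMeasure]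

theorem HasCompactSupport.measure_ball_mul_enorm_le_ballPotential [Nontrivial E] {f : E → ℝ}
    (hf : ContDiff ℝ 2 f) (hc : HasCompactSupport f) (x : E) :
    μ (Metric.ball 0 1) * ‖f x‖ₑ ≤ ballPotential μ (fun y => ‖fderiv ℝ (fderiv ℝ f) y‖ₑ) x := by
  have hf1 : ContDiff ℝ 1 (fderiv ℝ f) := hf.fderiv_right (by norm_num)
  have hcont := hf1.continuous_fderiv (by norm_num)
  calc
    μ (Metric.ball 0 1) * ‖f x‖ₑ = ∫⁻ _z in Metric.ball (0 : E) 1, ‖f x‖ₑ ∂μ := by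
      rw [setLIntegral_const, mul_comm]
    _ ≤ ∫⁻ z in Metric.ball (0 : E) 1, (∫⁻ r in Ioi (0 : ℝ),
          ENNReal.ofReal r * ‖fderiv ℝ (fderiv ℝ f) (x + r • z)‖ₑ) ∂μ := by
      refine lintegral_mono_ae ?_
      have h0 : ∀ᵐ z ∂μ, z ≠ 0 := by simp [ae_iff]
      filter_upwards [ae_restrict_of_ae h0, ae_restrict_mem measurableSet_ball] with z hz hzb
      exact hc.enorm_le_lintegral_fderiv_fderiv hf x hz (by simpa using (Metric.mem_ball.1 hzb).le)
    _ = ballPotential μ (fun y => ‖fderiv ℝ (fderiv ℝ f) y‖ₑ) x := by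
      rw [lintegral_lintegral_swap]
      · refine lintegral_congr fun r => lintegral_const_mul _ ?_
        exact Continuous.measurable (by fun_prop)
      · have hm : Measurable fun p : E × ℝ => ‖fderiv ℝ (fderiv ℝ f) (x + p.2 • p.1)‖ₑ :=
          Continuous.measurable (by fun_prop)
        exact ((by fun_prop : Measurable fun p : E × ℝ => ENNReal.ofReal p.2).mul hm).aemeasurable

theorem setLIntegral_ball_indicator_comp_le {A : Set E} (hA : MeasurableSet A) (x : E) {r : ℝ}
    (hr : 0 < r) :
    ∫⁻ z in Metric.ball (0 : E) 1, A.indicator 1 (x + r • z) ∂μ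
      ≤ min (μ (Metric.ball 0 1))
        (ENNReal.ofReal (r ^ (-(Module.finrank ℝ E : ℝ))) * μ A) := by
  have hm : Measurable fun z : E => x + r • z := by fun_prop
  have h : ∫⁻ z in Metric.ball (0 : E) 1, A.indicator 1 (x + r • z) ∂μ
      = μ ((fun z => x + r • z) ⁻¹' A ∩ Metric.ball 0 1) := by
    rw [← Measure.restrict_apply (hm hA), ← lintegral_indicator_one (hm hA)]
    rfl
  rw [h]
  refine le_min (measure_mono inter_subset_right) ((measure_mono inter_subset_left).trans_eq ?_)
  rw [show (fun z : E => x + r • z) ⁻¹' A = (r • ·) ⁻¹' ((x + ·) ⁻¹' A) from rfl,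
    Measure.addHaar_preimage_smul μ hr.ne', measure_preimage_add, Real.rpow_neg hr.le,
    Real.rpow_natCast, abs_of_nonneg (by positivity)]

/-- Integrating in `z` first gives the bound with factor `μ S`. Integrating in `x` first and using
translation invariance gives `μ A * μ (ball 0 1)`. The remaining term, `r^(-d) μ(S) μ(A)`, is
symmetric in the two sets. -/
theorem setLIntegral_setLIntegral_ball_indicator_le {S A : Set E} (hA : MeasurableSet A) {r : ℝ} (hr : 0 < r) :
    ∫⁻ x in S, ∫⁻ z in Metric.ball (0 : E) 1, A.indicator 1 (x + r • z) ∂μ ∂μ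
      ≤ min (μ S * min (μ (Metric.ball 0 1))
          (ENNReal.ofReal (r ^ (-(Module.finrank ℝ E : ℝ))) * μ A))
        (μ A * min (μ (Metric.ball 0 1))
          (ENNReal.ofReal (r ^ (-(Module.finrank ℝ E : ℝ))) * μ S)) := by
  have h1 : ∫⁻ x in S, ∫⁻ z in Metric.ball (0 : E) 1, A.indicator 1 (x + r • z) ∂μ ∂μ
      ≤ μ S * min (μ (Metric.ball 0 1))
          (ENNReal.ofReal (r ^ (-(Module.finrank ℝ E : ℝ))) * μ A) := by
    refine (lintegral_mono fun x => setLIntegral_ball_indicator_comp_le hA x hr).trans_eq ?_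
    rw [setLIntegral_const, mul_comm]
  refine le_min h1 ?_
  rw [mul_min]
  refine le_min ?_ (h1.trans ?_)
  · rw [lintegral_lintegral_swap]
    · calc
        _ ≤ ∫⁻ _z in Metric.ball (0 : E) 1, μ A ∂μ := by
          refine lintegral_mono fun z => ?_
          refine (setLIntegral_le_lintegral _ _).trans_eq ?_
          rw [lintegral_add_right_eq_self (μ := μ) (A.indicator 1) (r • z),
            lintegral_indicator_one hA]
        _ = _ := by rw [setLIntegral_const]
    · exact ((measurable_one.indicator hA).comp
        (by fun_prop : Measurable fun p : E × E => p.1 + r • p.2)).aemeasurable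
  · calc
      _ ≤ μ S * (ENNReal.ofReal (r ^ (-(Module.finrank ℝ E : ℝ))) * μ A) := by
        gcongr; exact min_le_right _ _
      _ = _ := by ring

theorem measurable_ballPotential {Y : Type*} [MeasurableSpace Y] {G : Y × E → ℝ≥0∞}
    (hG : Measurable G) :
    Measurable fun p : Y × E => ballPotential μ (fun e => G (p.1, e)) p.2 := by
  have h : Measurable fun q : (Y × E) × ℝ =>
      ∫⁻ z in Metric.ball (0 : E) 1, G (q.1.1, q.1.2 + q.2 • z) ∂μ :=
    Measurable.lintegral_prod_right'
      (f := fun w : ((Y × E) × ℝ) × E => G (w.1.1.1, w.1.1.2 + w.1.2 • w.2))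
      (hG.comp (by fun_prop))
  exact Measurable.lintegral_prod_right' (f := fun q : (Y × E) × ℝ => ENNReal.ofReal q.2 *
      ∫⁻ z in Metric.ball (0 : E) 1, G (q.1.1, q.1.2 + q.2 • z) ∂μ) (by fun_prop)

/-- The radial integral turns each of the two bounds at fixed `r` into one entry of the minimum.
Keeping both entries is essential: together they give the kernel that is bounded on `L²`. -/
theorem setLIntegral_ballPotential_indicator_le {S A : Set E} (hA : MeasurableSet A) (hd : 2 < (Module.finrank ℝ E : ℝ)) :
    ∫⁻ x in S, ballPotential μ (A.indicator 1) x ∂μ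
      ≤ ENNReal.ofReal ((μ (Metric.ball (0 : E) 1)).toReal / 2
          + 1 / ((Module.finrank ℝ E : ℝ) - 2))
        * min (μ S * μ A ^ (2 / (Module.finrank ℝ E : ℝ)))
          (μ A * μ S ^ (2 / (Module.finrank ℝ E : ℝ))) := by
  set d : ℝ := (Module.finrank ℝ E : ℝ)
  set K := ENNReal.ofReal ((μ (Metric.ball (0 : E) 1)).toReal / 2 + 1 / (d - 2))
  have hb : μ (Metric.ball (0 : E) 1) ≠ ∞ := measure_ball_lt_top.ne
  have hind : Measurable (A.indicator (1 : E → ℝ≥0∞)) := measurable_one.indicator hA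
  have hmeas : Measurable fun p : E × ℝ =>
      ∫⁻ z in Metric.ball (0 : E) 1, A.indicator (1 : E → ℝ≥0∞) (p.1 + p.2 • z) ∂μ :=
    Measurable.lintegral_prod_right'
      (f := fun w : (E × ℝ) × E => A.indicator (1 : E → ℝ≥0∞) (w.1.1 + w.1.2 • w.2))
      (hind.comp (by fun_prop))
  have h1 : ∫⁻ x in S, ballPotential μ (A.indicator 1) x ∂μ
      = ∫⁻ r in Ioi (0 : ℝ), ENNReal.ofReal r * ∫⁻ x in S, ∫⁻ z in Metric.ball (0 : E) 1,
          A.indicator 1 (x + r • z) ∂μ ∂μ := by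
    unfold ballPotential
    rw [lintegral_lintegral_swap]
    · exact lintegral_congr fun r => lintegral_const_mul _ (hmeas.comp measurable_prodMk_right)
    · exact ((by fun_prop : Measurable fun p : E × ℝ => ENNReal.ofReal p.2).mul hmeas).aemeasurable
  have h2 (M N : ℝ≥0∞) : ∫⁻ r in Ioi (0 : ℝ), ENNReal.ofReal r * (N * min (μ (Metric.ball (0 : E) 1))
      (ENNReal.ofReal (r ^ (-d)) * M)) ≤ K * (N * M ^ (2 / d)) := by
    calc
      _ = N * ∫⁻ r in Ioi (0 : ℝ), ENNReal.ofReal r * min (μ (Metric.ball (0 : E) 1))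
            (ENNReal.ofReal (r ^ (-d)) * M) := by
        rw [← lintegral_const_mul _ (by fun_prop)]
        refine lintegral_congr fun r => by ring
      _ ≤ N * (K * M ^ (2 / d)) := by
        gcongr
        exact lintegral_mul_min_rpow_le hb hd
      _ = _ := by ring
  rw [h1, mul_min]
  refine le_min ((setLIntegral_mono' measurableSet_Ioi fun r (hr : 0 < r) => ?_).trans
    (h2 (μ A) (μ S))) ((setLIntegral_mono' measurableSet_Ioi fun r (hr : 0 < r) => ?_).trans
    (h2 (μ S) (μ A)))
  · gcongr
    exact (setLIntegral_setLIntegral_ball_indicator_le hA hr).trans (min_le_left _ _)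
  · gcongr
    exact (setLIntegral_setLIntegral_ball_indicator_le hA hr).trans (min_le_right _ _)

theorem ballPotential_eq_lintegral {F : E → ℝ≥0∞} (hF : Measurable F) (x : E) :
    ballPotential μ F x = ∫⁻ s in Ioi (0 : ℝ),
      ballPotential μ ({y | ENNReal.ofReal s < F y}.indicator 1) x := by
  have hG : Measurable fun p : ℝ × E =>
      ({y | ENNReal.ofReal p.1 < F y}.indicator 1 p.2 : ℝ≥0∞) :=
    measurable_one.indicator (measurableSet_ofReal_lt measurable_fst (hF.comp measurable_snd))
  have hF' (y : E) : F y
      = ∫⁻ s in Ioi (0 : ℝ), {y | ENNReal.ofReal s < F y}.indicator 1 y := by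
    conv_lhs => rw [← lintegral_Ioi_indicator_ofReal_lt (F y)]
    rfl
  unfold ballPotential
  rw [lintegral_lintegral_swap]
  · refine lintegral_congr fun r => ?_
    rw [lintegral_const_mul]
    · congr 1
      rw [lintegral_lintegral_swap]
      · exact lintegral_congr fun z => hF' _
      · exact (hG.comp (by fun_prop : Measurable fun p : ℝ × E => (p.1, x + r • p.2))).aemeasurable
    · exact Measurable.lintegral_prod_right' (f := fun p : ℝ × E =>
        ({y | ENNReal.ofReal p.1 < F y}.indicator 1 (x + r • p.2) : ℝ≥0∞))
        (hG.comp (by fun_prop : Measurable fun p : ℝ × E => (p.1, x + r • p.2)))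
  · refine (Measurable.mul (by fun_prop) ?_).aemeasurable
    exact Measurable.lintegral_prod_right' (f := fun p : (ℝ × ℝ) × E =>
        ({y | ENNReal.ofReal p.1.1 < F y}.indicator 1 (x + p.1.2 • p.2) : ℝ≥0∞))
        (hG.comp (by fun_prop : Measurable fun p : (ℝ × ℝ) × E => (p.1.1, x + p.1.2 • p.2)))

theorem setLIntegral_ballPotential_le {F : E → ℝ≥0∞} (hF : Measurable F) {S : Set E}
    (hS0 : μ S ≠ 0) (hSt : μ S ≠ ∞)
    (hd : 2 < (Module.finrank ℝ E : ℝ)) :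
    ∫⁻ x in S, ballPotential μ F x ∂μ
      ≤ ENNReal.ofReal ((μ (Metric.ball (0 : E) 1)).toReal / 2
          + 1 / ((Module.finrank ℝ E : ℝ) - 2))
        * (μ S * potentialMajorant (2 / (Module.finrank ℝ E : ℝ))
          (fun s => μ {y | ENNReal.ofReal s < F y}) (μ S).toReal) := by
  have hG : Measurable fun p : ℝ × E =>
      ({y | ENNReal.ofReal p.1 < F y}.indicator 1 p.2 : ℝ≥0∞) :=
    measurable_one.indicator (measurableSet_ofReal_lt measurable_fst (hF.comp measurable_snd))
  have hα : Measurable fun s : ℝ => μ {y | ENNReal.ofReal s < F y} :=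
    (antitone_measure_ofReal_lt F).measurable
  have hpos : 0 < (μ S).toReal := ENNReal.toReal_pos hS0 hSt
  set d : ℝ := (Module.finrank ℝ E : ℝ)
  set K := ENNReal.ofReal ((μ (Metric.ball (0 : E) 1)).toReal / 2 + 1 / (d - 2))
  calc
    ∫⁻ x in S, ballPotential μ F x ∂μ
      = ∫⁻ s in Ioi (0 : ℝ), ∫⁻ x in S,
          ballPotential μ ({y | ENNReal.ofReal s < F y}.indicator 1) x ∂μ := by
        simp_rw [ballPotential_eq_lintegral hF]
        exact lintegral_lintegral_swap
          ((measurable_ballPotential hG).comp measurable_swap).aemeasurable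
    _ ≤ ∫⁻ s in Ioi (0 : ℝ), K * (μ S * min (μ {y | ENNReal.ofReal s < F y} ^ (2 / d))
          (μ {y | ENNReal.ofReal s < F y} * ENNReal.ofReal ((μ S).toReal ^ (2 / d - 1)))) := by
        refine lintegral_mono fun s => ?_
        refine (setLIntegral_ballPotential_indicator_le
          (measurableSet_ofReal_lt measurable_const hF) hd).trans_eq ?_
        congr 1
        -- The factor `μ S` is pulled out of the minimum, turning `μ(S)^a` into `μ(S)^(a-1)`.
        rw [mul_min, ← ENNReal.ofReal_rpow_of_pos hpos, ENNReal.ofReal_toReal hSt,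
          mul_left_comm (μ S), ENNReal.rpow_sub _ _ hS0 hSt, ENNReal.rpow_one,
          ENNReal.mul_div_cancel hS0 hSt]
    _ = _ := by
        have hm : Measurable fun s : ℝ => min (μ {y | ENNReal.ofReal s < F y} ^ (2 / d))
            (μ {y | ENNReal.ofReal s < F y} * ENNReal.ofReal ((μ S).toReal ^ (2 / d - 1))) :=
          (hα.pow_const _).min (hα.mul_const _)
        rw [lintegral_const_mul _ (hm.const_mul _), lintegral_const_mul _ hm]
        rfl

end Potential

/-! ### Lorentz norms of functions with a dominated rearrangement -/

section LorentzBounds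

open Filter Topology

variable {X : Type*} [MeasurableSpace X] {μ : Measure X} {f : X → ℝ} {a p : ℝ} {H : ℝ → ℝ≥0∞}

theorem eLpNorm_two_eq_lintegral_sq {Y : Type*} [MeasurableSpace Y] (ν : Measure Y)
    (g : Y → ℝ≥0∞) : eLpNorm g 2 ν = (∫⁻ y, g y ^ 2 ∂ν) ^ (1 / 2 : ℝ) := by
  rw [eLpNorm_eq_lintegral_rpow_enorm_toReal (by norm_num) (by norm_num)]
  simp

theorem lorentzQuasiNorm_two_le (hp : 1 / p - 1 / 2 = -a)
    (hH : ∀ t, 0 < t → decreasingRearrangement μ f t ≤ H t) :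
    lorentzQuasiNorm p 2 μ f
      ≤ (∫⁻ t in Ioi 0, (ENNReal.ofReal (t ^ (-a)) * H t) ^ 2) ^ (1 / 2 : ℝ) := by
  rw [lorentzQuasiNorm, eLpNorm_two_eq_lintegral_sq, ENNReal.toReal_ofNat, hp]
  gcongr ?_ ^ (1 / 2 : ℝ)
  refine setLIntegral_mono' measurableSet_Ioi fun t ht => ?_
  gcongr
  exact hH t ht

/-- With `g = t^(-a) H`, the quantity `t^(-a) f^{**}(t)` is at most the averaging kernel applied to
`g`, so Hardy's inequality applies. Only the majorant `H` has to be measurable. -/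
theorem lorentzNorm_two_le (ha : 0 < a) (hp : 1 / p - 1 / 2 = -a) (hHm : Measurable H)
    (hH : ∀ t, 0 < t → decreasingRearrangement μ f t ≤ H t) :
    lorentzNorm p 2 μ f ≤ ENNReal.ofReal (1 / (a + 1 / 2))
      * (∫⁻ t in Ioi 0, (ENNReal.ofReal (t ^ (-a)) * H t) ^ 2) ^ (1 / 2 : ℝ) := by
  set g : ℝ → ℝ≥0∞ := fun t => ENNReal.ofReal (t ^ (-a)) * H t with hg
  have hgm : Measurable g := by fun_prop
  rw [lorentzNorm, eLpNorm_two_eq_lintegral_sq, ENNReal.toReal_ofNat, hp]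
  have h1 : ∫⁻ t in Ioi 0, (ENNReal.ofReal (t ^ (-a)) * maximalRearrangement μ f t) ^ 2
      ≤ ∫⁻ t in Ioi 0, (∫⁻ τ in Ioi 0, averagingKernel a t τ * g τ) ^ 2 := by
    refine setLIntegral_mono' measurableSet_Ioi fun t (ht : 0 < t) => ?_
    gcongr
    have hsub : (∫⁻ τ in Ioi (0 : ℝ), averagingKernel a t τ * g τ)
        ≥ ∫⁻ τ in Ioo 0 t, averagingKernel a t τ * g τ :=
      lintegral_mono_set Ioo_subset_Ioi_self
    refine le_trans ?_ hsub
    rw [maximalRearrangement, ENNReal.div_eq_inv_mul, ← mul_assoc, ← ENNReal.ofReal_inv_of_pos ht,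
      ← ENNReal.ofReal_mul (by positivity)]
    calc
      _ ≤ ENNReal.ofReal (t ^ (-a) * t⁻¹) * ∫⁻ τ in Ioo 0 t, H τ := by
        refine mul_le_mul' le_rfl ?_
        exact setLIntegral_mono' measurableSet_Ioo fun τ hτ => hH τ hτ.1
      _ = ∫⁻ τ in Ioo 0 t, ENNReal.ofReal (t ^ (-a) * t⁻¹) * H τ :=
        (lintegral_const_mul _ hHm).symm
      _ ≤ _ := by
        refine setLIntegral_mono' measurableSet_Ioo fun τ hτ => ?_
        have hτ0 : 0 < τ := hτ.1
        rw [averagingKernel, if_pos hτ.2, hg, ← mul_assoc, ← ENNReal.ofReal_mul (by positivity)]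
        refine le_of_eq ?_
        congr 2
        rw [mul_assoc, ← Real.rpow_add hτ0, add_neg_cancel, Real.rpow_zero, mul_one,
          sub_eq_add_neg, Real.rpow_add ht, Real.rpow_neg_one]
  calc
    _ ≤ (ENNReal.ofReal (1 / (a + 1 / 2)) ^ 2 * ∫⁻ t in Ioi 0, g t ^ 2) ^ (1 / 2 : ℝ) := by
      gcongr ?_ ^ (1 / 2 : ℝ)
      refine h1.trans ?_
      rw [pow_two]
      exact lintegral_averagingKernel_sq_le ha hgm
    _ = _ := by
      rw [ENNReal.mul_rpow_of_nonneg _ _ (by norm_num), ← ENNReal.rpow_natCast,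
        ← ENNReal.rpow_mul]
      norm_num [hg]

theorem lintegral_sq_liminf_le {Y : Type*} [MeasurableSpace Y] {ν : Measure Y} {c : Y → ℝ≥0∞}
    (hc : ∀ y, c y ≠ ∞) (hcm : Measurable c) {h : ℕ → Y → ℝ≥0∞} (hh : ∀ n, Measurable (h n)) :
    ∫⁻ y, (c y * liminf (fun n => h n y) atTop) ^ 2 ∂ν
      ≤ liminf (fun n => ∫⁻ y, (c y * h n y) ^ 2 ∂ν) atTop := by
  refine le_trans (le_of_eq (lintegral_congr fun y => ?_)) (lintegral_liminf_le fun n => by fun_prop)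
  have hmono : Monotone fun x : ℝ≥0∞ => (c y * x) ^ 2 := fun x x' hx => by dsimp only; gcongr
  have hcont : Continuous fun x : ℝ≥0∞ => (c y * x) ^ 2 :=
    (ENNReal.continuous_pow 2).comp (ENNReal.continuous_const_mul (hc y))
  exact hmono.map_liminf_of_continuousAt (fun n => h n y) hcont.continuousAt

end LorentzBounds

/-! ### Rearrangement estimate for limits of smooth functions -/

section RearrangementEstimate

open Filter Topology

variable {E : Type*} [NormedAddCommGroup E] [NormedSpace ℝ E] [MeasurableSpace E] {μ : Measure E}

/-- The constant in the rearrangement estimate for the potential of order two. -/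
noncomputable def potentialConst (μ : Measure E) : ℝ≥0∞ :=
  ENNReal.ofReal ((μ (Metric.ball (0 : E) 1)).toReal / 2 + 1 / ((Module.finrank ℝ E : ℝ) - 2))
    / μ (Metric.ball (0 : E) 1)

theorem potentialConst_ne_top [μ.IsAddHaarMeasure] : potentialConst μ ≠ ∞ :=
  ENNReal.div_ne_top ENNReal.ofReal_ne_top (Metric.measure_ball_pos μ 0 one_pos).ne'

/-- The distribution function of the norm of the second derivative. -/
noncomputable def hessianDistribution (μ : Measure E) (φ : E → ℝ) (s : ℝ) : ℝ≥0∞ :=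
  μ {y | ENNReal.ofReal s < ‖fderiv ℝ (fderiv ℝ φ) y‖ₑ}

variable [FiniteDimensional ℝ E] [BorelSpace E] [μ.IsAddHaarMeasure]

/-- If some `v` lies strictly between the two sides, the superlevel set of `f` at height `v` has
measure at least `t`, yet the potential estimate makes the mean of `|f|` on it at most the right
side, hence below `v`. The set depends on the limit `f` only, so Fatou's lemma can be applied on it.
-/
theorem decreasingRearrangement_le_liminf (hd : 2 < (Module.finrank ℝ E : ℝ)) {Ω : Set E}
    (hΩ : MeasurableSet Ω) {φ : ℕ → E → ℝ} (hφ : ∀ n, ContDiff ℝ 2 (φ n))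
    (hc : ∀ n, HasCompactSupport (φ n)) {f : E → ℝ} (hfm : Measurable f) {p : ℝ≥0∞} (hp0 : p ≠ 0)
    (hpt : p ≠ ∞) (hf : MemLp f p (μ.restrict Ω))
    (hlim : ∀ᵐ x ∂μ.restrict Ω, Tendsto (fun n => φ n x) atTop (𝓝 (f x))) {t : ℝ} (ht : 0 < t) :
    decreasingRearrangement (μ.restrict Ω) f t ≤ potentialConst μ
      * liminf (fun n => potentialMajorant (2 / (Module.finrank ℝ E : ℝ))
          (hessianDistribution μ (φ n)) t) atTop := by
  have hdpos : 0 < Module.finrank ℝ E := by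
    have : (0 : ℝ) < Module.finrank ℝ E := by linarith
    exact_mod_cast this
  have : Nontrivial E := Module.nontrivial_of_finrank_pos hdpos
  by_contra! hcon
  obtain ⟨v, hv1, hv2⟩ := ENNReal.lt_iff_exists_nnreal_btwn.1 hcon
  have hv0 : 0 < (v : ℝ) := by
    have : (0 : ℝ≥0∞) < v := hv1.bot_lt
    exact_mod_cast this
  set S : Set E := {x | (v : ℝ) < |f x|} ∩ Ω with hS
  have hlt : MeasurableSet {x | (v : ℝ) < |f x|} := measurableSet_lt measurable_const (by fun_prop)
  have hSm : MeasurableSet S := hlt.inter hΩ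
  have hSe : μ S = distributionFunction (μ.restrict Ω) f v :=
    (Measure.restrict_apply hlt).symm
  -- Otherwise `v` would be admissible in the infimum defining `f^*(t)`, contradicting `v < f^*(t)`.
  have htS : ENNReal.ofReal t ≤ μ S := by
    by_contra! h
    refine hv2.not_ge ?_
    rw [decreasingRearrangement, if_pos ht, ← ENNReal.ofReal_coe_nnreal (p := v)]
    exact iInf₂_le (v : ℝ) ⟨hv0, hSe ▸ h⟩
  have hS0 : μ S ≠ 0 := ((ENNReal.ofReal_pos.2 ht).trans_le htS).ne'
  have hSt : μ S ≠ ∞ := by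
    rw [hSe]
    refine ((measure_mono fun x (hx : (v : ℝ) < |f x|) => ?_).trans_lt
      (hf.meas_ge_lt_top hp0 hpt (ε := v) (by simpa using hv0.ne'))).ne
    exact hx.le
  have htS' : t ≤ (μ S).toReal := (ENNReal.ofReal_le_iff_le_toReal hSt).1 htS
  set K := ENNReal.ofReal ((μ (Metric.ball (0 : E) 1)).toReal / 2
    + 1 / ((Module.finrank ℝ E : ℝ) - 2)) with hK
  set b := μ (Metric.ball (0 : E) 1) with hb
  have hb0 : b ≠ 0 := (Metric.measure_ball_pos μ 0 one_pos).ne'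
  have hbt : b ≠ ∞ := measure_ball_lt_top.ne
  set L := liminf (fun n => potentialMajorant (2 / (Module.finrank ℝ E : ℝ))
          (hessianDistribution μ (φ n)) t) atTop with hL
  have hlimS : ∀ᵐ x ∂μ.restrict S, Tendsto (fun n => φ n x) atTop (𝓝 (f x)) :=
    ae_mono (Measure.restrict_mono inter_subset_right le_rfl) hlim
  have key : μ S * (b * v) ≤ μ S * (K * L) := by
    calc
      μ S * (b * v) = ∫⁻ _x in S, b * v ∂μ := by rw [setLIntegral_const, mul_comm]
      _ ≤ ∫⁻ x in S, b * ‖f x‖ₑ ∂μ := by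
        refine setLIntegral_mono' hSm fun x hx => ?_
        gcongr
        rw [← ENNReal.ofReal_coe_nnreal, Real.enorm_eq_ofReal_abs]
        exact ENNReal.ofReal_le_ofReal hx.1.le
      _ = ∫⁻ x in S, liminf (fun n => b * ‖φ n x‖ₑ) atTop ∂μ := by
        refine lintegral_congr_ae ?_
        filter_upwards [hlimS] with x hx
        exact ((ENNReal.Tendsto.const_mul ((continuous_enorm.tendsto _).comp hx)
          (Or.inr hbt)).liminf_eq).symm
      _ ≤ liminf (fun n => ∫⁻ x in S, b * ‖φ n x‖ₑ ∂μ) atTop :=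
        lintegral_liminf_le fun n => by
          have := (hφ n).continuous.measurable
          fun_prop
      _ ≤ liminf (fun n => μ S * K * potentialMajorant (2 / (Module.finrank ℝ E : ℝ))
          (hessianDistribution μ (φ n)) t) atTop := by
        refine liminf_le_liminf (.of_forall fun n => ?_)
        have hm : Measurable fun y => ‖fderiv ℝ (fderiv ℝ (φ n)) y‖ₑ := by
          have := ((hφ n).fderiv_right (m := 1) (by norm_num)).continuous_fderiv (by norm_num)
          exact this.enorm.measurable
        refine (lintegral_mono fun x =>
          (hc n).measure_ball_mul_enorm_le_ballPotential (hφ n) x).trans ?_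
        refine (setLIntegral_ballPotential_le hm hS0 hSt hd).trans ?_
        rw [← mul_assoc, mul_comm _ (μ S)]
        refine mul_le_mul' le_rfl ?_
        -- The potential estimate gives the majorant at `μ S`; since `t ≤ μ S` it may be replaced by
        -- its value at `t`.
        refine potentialMajorant_anti ?_ _ ht htS'
        rw [div_le_one (by linarith)]
        exact hd.le
      _ = μ S * (K * L) := by
        have hmono : Monotone fun x : ℝ≥0∞ => μ S * K * x := fun x x' hx => by dsimp only; gcongr
        have hcont : Continuous fun x : ℝ≥0∞ => μ S * K * x :=
          ENNReal.continuous_const_mul (ENNReal.mul_ne_top hSt ENNReal.ofReal_ne_top)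
        rw [← mul_assoc]
        exact (hmono.map_liminf_of_continuousAt _ hcont.continuousAt).symm
  have key2 : b * v ≤ K * L := (ENNReal.mul_le_mul_iff_right hS0 hSt).1 key
  refine hv1.not_ge ?_
  calc (v : ℝ≥0∞) = b * v / b := by rw [mul_comm, ENNReal.mul_div_cancel_right hb0 hbt]
    _ ≤ K * L / b := by gcongr
    _ = potentialConst μ * L := by rw [potentialConst, ENNReal.mul_div_right_comm]

theorem lintegral_potentialMajorant_hessianDistribution_sq_le
    (hd : 4 < (Module.finrank ℝ E : ℝ)) {φ : E → ℝ} (hφ : ContDiff ℝ 2 φ)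
    (hc : HasCompactSupport φ) :
    ∫⁻ t in Ioi 0, (ENNReal.ofReal (t ^ (-(2 / (Module.finrank ℝ E : ℝ))))
        * potentialMajorant (2 / (Module.finrank ℝ E : ℝ)) (hessianDistribution μ φ) t) ^ 2
      ≤ (ENNReal.ofReal (2 + 1 / (1 / 2 - 2 / (Module.finrank ℝ E : ℝ)))
        * eLpNorm (fderiv ℝ (fderiv ℝ φ)) 2 μ) ^ 2 := by
  have hcont := (hφ.fderiv_right (m := 1) (by norm_num)).continuous_fderiv (by norm_num)
  have hcs : HasCompactSupport (fderiv ℝ (fderiv ℝ φ)) := (hc.fderiv (𝕜 := ℝ)).fderiv (𝕜 := ℝ)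
  refine (lintegral_potentialMajorant_sq_le ?_ hcont.enorm.measurable fun s hs => ?_).trans_eq ?_
  · rw [div_lt_div_iff₀ (by linarith) (by norm_num)]
    linarith
  · refine ((measure_mono fun y hy => subset_tsupport _ ?_).trans_lt
      hcs.isCompact.measure_lt_top).ne
    intro h0
    refine (lt_irrefl (0 : ℝ≥0∞)) (bot_le.trans_lt (hy.trans_eq ?_))
    rw [h0, ← ofReal_norm, norm_zero, ENNReal.ofReal_zero]
  · rw [mul_pow, eLpNorm_eq_lintegral_rpow_enorm_toReal (by norm_num) (by norm_num),
      ← ENNReal.rpow_natCast ((∫⁻ _, _ ∂μ) ^ _), ← ENNReal.rpow_mul]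
    norm_num

/-- The liminf of the majorants dominates `f^*`; Fatou's lemma in `t` then transfers their uniform
weighted `L²` bounds to it. -/
theorem lorentzNorms_le_of_tendsto (hd : 4 < (Module.finrank ℝ E : ℝ)) {Ω : Set E}
    (hΩ : MeasurableSet Ω) {φ : ℕ → E → ℝ} (hφ : ∀ n, ContDiff ℝ 2 (φ n))
    (hc : ∀ n, HasCompactSupport (φ n)) {f : E → ℝ} (hfm : Measurable f) {p : ℝ≥0∞} (hp0 : p ≠ 0)
    (hpt : p ≠ ∞) (hf : MemLp f p (μ.restrict Ω))
    (hlim : ∀ᵐ x ∂μ.restrict Ω, Tendsto (fun n => φ n x) atTop (𝓝 (f x)))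
    {m : ℕ → ℝ≥0∞} {M : ℝ≥0∞} (hm : ∀ n, eLpNorm (fderiv ℝ (fderiv ℝ (φ n))) 2 μ ≤ m n)
    (hmM : Tendsto m atTop (𝓝 M)) {q : ℝ}
    (hq : 1 / q - 1 / 2 = -(2 / (Module.finrank ℝ E : ℝ))) :
    lorentzQuasiNorm q 2 (μ.restrict Ω) f ≤ potentialConst μ
        * ENNReal.ofReal (2 + 1 / (1 / 2 - 2 / (Module.finrank ℝ E : ℝ))) * M ∧
      lorentzNorm q 2 (μ.restrict Ω) f ≤
        ENNReal.ofReal (1 / (2 / (Module.finrank ℝ E : ℝ) + 1 / 2)) * (potentialConst μ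
          * ENNReal.ofReal (2 + 1 / (1 / 2 - 2 / (Module.finrank ℝ E : ℝ))) * M) := by
  have hpos : 0 < 2 / (Module.finrank ℝ E : ℝ) := by
    have : (0 : ℝ) < Module.finrank ℝ E := by linarith
    positivity
  set a : ℝ := 2 / (Module.finrank ℝ E : ℝ)
  set A := ENNReal.ofReal (2 + 1 / (1 / 2 - a))
  set c := potentialConst μ with hcdef
  have hct : c ≠ ∞ := potentialConst_ne_top
  set h : ℕ → ℝ → ℝ≥0∞ := fun n => potentialMajorant a (hessianDistribution μ (φ n)) with hh
  have hhm n : Measurable (h n) := measurable_potentialMajorant a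
    (antitone_measure_ofReal_lt (fun y => ‖fderiv ℝ (fderiv ℝ (φ n)) y‖ₑ)).measurable
  set H : ℝ → ℝ≥0∞ := fun t => c * liminf (fun n => h n t) atTop with hH
  have hHm : Measurable H := (Measurable.liminf hhm).const_mul _
  have hle t (ht : 0 < t) : decreasingRearrangement (μ.restrict Ω) f t ≤ H t :=
    decreasingRearrangement_le_liminf (by linarith) hΩ hφ hc hfm hp0 hpt hf hlim ht
  have hint : (∫⁻ t in Ioi 0, (ENNReal.ofReal (t ^ (-a)) * H t) ^ 2) ^ (1 / 2 : ℝ) ≤ c * A * M := by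
    have h1 : ∫⁻ t in Ioi 0, (ENNReal.ofReal (t ^ (-a)) * H t) ^ 2 ≤ (c * A * M) ^ 2 := by
      calc
        _ = ∫⁻ t in Ioi 0, (ENNReal.ofReal (t ^ (-a)) * c * liminf (fun n => h n t) atTop) ^ 2 := by
          simp_rw [hH, mul_assoc]
        _ ≤ liminf (fun n => ∫⁻ t in Ioi 0, (ENNReal.ofReal (t ^ (-a)) * c * h n t) ^ 2) atTop :=
          lintegral_sq_liminf_le (fun t => ENNReal.mul_ne_top ENNReal.ofReal_ne_top hct)
            (by fun_prop) hhm
        _ ≤ liminf (fun n => (c * A * m n) ^ 2) atTop := by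
          refine liminf_le_liminf (.of_forall fun n => ?_)
          have hmeas : Measurable fun t => (ENNReal.ofReal (t ^ (-a)) * h n t) ^ 2 := by
            have := hhm n
            fun_prop
          calc
            _ = c ^ 2 * ∫⁻ t in Ioi 0, (ENNReal.ofReal (t ^ (-a)) * h n t) ^ 2 := by
              rw [← lintegral_const_mul _ hmeas]
              refine lintegral_congr fun t => by ring
            _ ≤ c ^ 2 * (A * eLpNorm (fderiv ℝ (fderiv ℝ (φ n))) 2 μ) ^ 2 := by
              gcongr
              exact lintegral_potentialMajorant_hessianDistribution_sq_le hd (hφ n) (hc n)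
            _ ≤ c ^ 2 * (A * m n) ^ 2 := by
              gcongr
              exact hm n
            _ = _ := by ring
        _ = (c * A * M) ^ 2 := by
          refine Tendsto.liminf_eq ?_
          exact ((ENNReal.continuous_pow 2).tendsto _).comp (ENNReal.Tendsto.const_mul hmM
            (Or.inr (ENNReal.mul_ne_top hct ENNReal.ofReal_ne_top)))
    calc
      _ ≤ ((c * A * M) ^ 2) ^ (1 / 2 : ℝ) := by gcongr
      _ = _ := by rw [← ENNReal.rpow_natCast, ← ENNReal.rpow_mul]; norm_num
  refine ⟨(lorentzQuasiNorm_two_le hq hle).trans hint, ?_⟩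
  refine (lorentzNorm_two_le hpos hq hHm hle).trans ?_
  gcongr

end RearrangementEstimate

/-! ### The embedding -/

section Embedding

open Filter Topology

variable {N : ℕ} {Ω : Opens (EuclideanSpace ℝ (Fin N))}

namespace SmoothCompact

theorem contDiff (φ : SmoothCompact Ω) : ContDiff ℝ (⊤ : ℕ∞) φ.toFun :=
  TestFunction.contDiff' φ

theorem hasCompactSupport (φ : SmoothCompact Ω) : HasCompactSupport φ.toFun :=
  TestFunction.hasCompactSupport' φ

theorem tsupport_subset (φ : SmoothCompact Ω) :
    tsupport φ.toFun ⊆ (Ω : Set (EuclideanSpace ℝ (Fin N))) :=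
  TestFunction.tsupport_subset' φ

theorem support_laplacian_subset (φ : SmoothCompact Ω) :
    Function.support (Δ φ.toFun) ⊆ (Ω : Set (EuclideanSpace ℝ (Fin N))) := by
  refine subset_trans (fun x hx => ?_) φ.tsupport_subset
  by_contra hxs
  refine hx ?_
  have h : φ.toFun =ᶠ[𝓝 x] fun _ => (0 : ℝ) := notMem_tsupport_iff_eventuallyEq.1 hxs
  rw [(InnerProductSpace.laplacian_congr_nhds h).eq_of_nhds,
    InnerProductSpace.laplacian_const]
  rfl

theorem continuous_laplacian (φ : SmoothCompact Ω) : Continuous (Δ φ.toFun) := by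
  rw [InnerProductSpace.laplacian_eq_iteratedFDeriv_stdOrthonormalBasis]
  have := φ.contDiff_two.continuous_iteratedFDeriv (m := 2) le_rfl
  fun_prop

theorem hasCompactSupport_laplacian (φ : SmoothCompact Ω) : HasCompactSupport (Δ φ.toFun) := by
  refine φ.hasCompactSupport.mono' fun x hx => ?_
  by_contra hxs
  refine hx ?_
  have h : φ.toFun =ᶠ[𝓝 x] fun _ => (0 : ℝ) := notMem_tsupport_iff_eventuallyEq.1 hxs
  rw [(InnerProductSpace.laplacian_congr_nhds h).eq_of_nhds,
    InnerProductSpace.laplacian_const]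
  rfl

theorem enorm_eq (φ : SmoothCompact Ω) : ‖φ‖ₑ = eLpNorm (Δ φ.toFun) 2 volume := by
  rw [← eLpNorm_restrict_eq_of_support_subset φ.support_laplacian_subset,
    ← Lp.enorm_toLp φ.memLp_laplacian]
  rfl

theorem eLpNorm_fderiv_fderiv_le (φ : SmoothCompact Ω) :
    eLpNorm (fderiv ℝ (fderiv ℝ φ.toFun)) 2 volume ≤ (N : ℝ≥0∞) ^ 2 * ‖φ‖ₑ := by
  have h := eLpNorm_fderiv_fderiv_le_laplacian φ.contDiff φ.hasCompactSupport
  rwa [finrank_euclideanSpace_fin, ← φ.enorm_eq] at h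

end SmoothCompact

/-- The critical exponent `2N / (N - 4)`. -/
noncomputable def criticalExponent (N : ℕ) : ℝ≥0 := (2 * (N : ℝ) / ((N : ℝ) - 4)).toNNReal

theorem coe_criticalExponent (hN : 5 ≤ N) :
    (criticalExponent N : ℝ) = 2 * (N : ℝ) / ((N : ℝ) - 4) := by
  have h : (5 : ℝ) ≤ N := by exact_mod_cast hN
  exact Real.coe_toNNReal _ (div_nonneg (by linarith) (by linarith))

theorem one_le_criticalExponent (hN : 5 ≤ N) : 1 ≤ criticalExponent N := by
  have h : (5 : ℝ) ≤ N := by exact_mod_cast hN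
  rw [← NNReal.coe_le_coe, coe_criticalExponent hN, NNReal.coe_one, one_le_div (by linarith)]
  linarith

/-- The Sobolev inequality is used twice, from `2` to `p₁ = 2N/(N-2)` for the gradient and from `p₁`
to `2N/(N-4)` for the function. This only realizes the completion as a space of functions; the
constant does not enter the Lorentz bound. -/
theorem exists_eLpNorm_criticalExponent_le (hN : 5 ≤ N) :
    ∃ C : ℝ≥0, ∀ (Ω : Opens (EuclideanSpace ℝ (Fin N))) (φ : SmoothCompact Ω),
      eLpNorm φ.toFun (criticalExponent N) volume ≤ C * ‖φ‖ₑ := by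
  have h : (5 : ℝ) ≤ N := by exact_mod_cast hN
  set p₁ : ℝ≥0 := (2 * (N : ℝ) / ((N : ℝ) - 2)).toNNReal with hp₁
  have hp₁c : (p₁ : ℝ) = 2 * (N : ℝ) / ((N : ℝ) - 2) :=
    Real.coe_toNNReal _ (div_nonneg (by linarith) (by linarith))
  have h1 : 1 ≤ p₁ := by
    rw [← NNReal.coe_le_coe, hp₁c, NNReal.coe_one, one_le_div (by linarith)]
    linarith
  have hfin : Module.finrank ℝ (EuclideanSpace ℝ (Fin N)) = N := finrank_euclideanSpace_fin
  set C₁ := SNormLESNormFDerivOfEqConst ℝ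
    (volume : Measure (EuclideanSpace ℝ (Fin N))) p₁
  set C₂ := SNormLESNormFDerivOfEqConst (EuclideanSpace ℝ (Fin N) →L[ℝ] ℝ)
    (volume : Measure (EuclideanSpace ℝ (Fin N))) (2 : ℝ≥0)
  refine ⟨C₁ * (C₂ * (N : ℝ≥0) ^ 2), fun Ω φ => ?_⟩
  have e1 : eLpNorm φ.toFun (criticalExponent N) volume
      ≤ C₁ * eLpNorm (fderiv ℝ φ.toFun) p₁ volume := by
    refine eLpNorm_le_eLpNorm_fderiv_of_eq volume (φ.contDiff.of_le (by simp))
      φ.hasCompactSupport h1 (by omega) ?_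
    rw [coe_criticalExponent hN, NNReal.coe_inv, hp₁c, hfin]
    have : (N : ℝ) - 4 ≠ 0 := by linarith
    have : (N : ℝ) - 2 ≠ 0 := by linarith
    field_simp
    ring
  have e2 : eLpNorm (fderiv ℝ φ.toFun) p₁ volume
      ≤ C₂ * eLpNorm (fderiv ℝ (fderiv ℝ φ.toFun)) 2 volume := by
    refine eLpNorm_le_eLpNorm_fderiv_of_eq (p := 2) volume
      (φ.contDiff_two.fderiv_right (by norm_num)) (φ.hasCompactSupport.fderiv (𝕜 := ℝ))
      (by norm_num) (by omega) ?_
    rw [hp₁c, hfin]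
    have : (N : ℝ) - 2 ≠ 0 := by linarith
    push_cast
    field_simp
  calc
    _ ≤ C₁ * (C₂ * ((N : ℝ≥0∞) ^ 2 * ‖φ‖ₑ)) := by
      refine e1.trans ?_
      gcongr
      refine e2.trans ?_
      gcongr
      exact φ.eLpNorm_fderiv_fderiv_le
    _ = _ := by
      push_cast
      ring

theorem SmoothCompact.memLp (φ : SmoothCompact Ω) (p : ℝ≥0∞) :
    MemLp φ.toFun p (volume.restrict (Ω : Set (EuclideanSpace ℝ (Fin N)))) :=
  (φ.contDiff.continuous.memLp_of_hasCompactSupport φ.hasCompactSupport).restrict _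

variable (Ω) in
/-- The inclusion of `C_c^∞(Ω)` into `L^p(Ω)`. -/
noncomputable def SmoothCompact.toLp (p : ℝ≥0∞) :
    SmoothCompact Ω →ₗ[ℝ] Lp ℝ p (volume.restrict (Ω : Set (EuclideanSpace ℝ (Fin N)))) where
  toFun φ := (φ.memLp p).toLp _
  map_add' φ ψ := MemLp.toLp_add (φ.memLp p) (ψ.memLp p)
  map_smul' c φ := MemLp.toLp_const_smul c (φ.memLp p)

theorem BeppoLevi.exists_seq_tendsto (u : BeppoLevi Ω) :
    ∃ φ : ℕ → SmoothCompact Ω, Tendsto (fun n => (φ n : BeppoLevi Ω)) atTop (𝓝 u) := by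
  obtain ⟨x, hx, hxu⟩ := mem_closure_iff_seq_limit.1
    ((UniformSpace.Completion.denseRange_coe (α := SmoothCompact Ω)) u)
  choose φ hφ using hx
  exact ⟨φ, by simpa only [hφ] using hxu⟩

/-- The extension to the completion of a linear map on `C_c^∞(Ω)` bounded by the norm of
`D^{2,2}_0(Ω)`. -/
theorem BeppoLevi.exists_extension {F : Type*} [NormedAddCommGroup F] [NormedSpace ℝ F]
    [CompleteSpace F] (T : SmoothCompact Ω →ₗ[ℝ] F) {C : ℝ} (hT : ∀ φ, ‖T φ‖ ≤ C * ‖φ‖) :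
    ∃ S : BeppoLevi Ω →L[ℝ] F, ∀ φ : SmoothCompact Ω, S φ = T φ :=
  ⟨(T.mkContinuous C hT).extend
      (UniformSpace.Completion.toComplL : SmoothCompact Ω →L[ℝ] BeppoLevi Ω),
    fun φ => (T.mkContinuous C hT).extend_eq UniformSpace.Completion.denseRange_coe
      (UniformSpace.Completion.isUniformInducing_coe _) φ⟩

theorem _root_.MeasureTheory.MemLp.exists_continuousLinearMap_integral_mul {X : Type*} [MeasurableSpace X]
    {ν : Measure X} {p q : ℝ≥0∞} [Fact (1 ≤ p)] [ENNReal.HolderConjugate p q] {h : X → ℝ}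
    (hh : MemLp h q ν) : ∃ ℓ : Lp ℝ p ν →L[ℝ] ℝ, ∀ g : Lp ℝ p ν, ℓ g = ∫ x, g x * h x ∂ν := by
  have : Fact (1 ≤ q) := ⟨ENNReal.HolderConjugate.one_le q p⟩
  refine ⟨((ContinuousLinearMap.mul ℝ ℝ).lpPairing ν p q).flip (hh.toLp _), fun g => ?_⟩
  rw [ContinuousLinearMap.flip_apply, ContinuousLinearMap.lpPairing_eq_integral]
  refine integral_congr_ae ?_
  filter_upwards [hh.coeFn_toLp] with x hx
  rw [hx, ContinuousLinearMap.mul_apply']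

/-- `L u` is the weak Laplacian of `S u`: both sides are continuous linear functionals of `u`, and
on the dense subspace of test functions they agree by integration by parts. -/
theorem integral_mul_laplacian_eq {p : ℝ≥0∞} [Fact (1 ≤ p)]
    {L : BeppoLevi Ω →L[ℝ] Lp ℝ 2 (volume.restrict (Ω : Set (EuclideanSpace ℝ (Fin N))))}
    (hL : ∀ φ : SmoothCompact Ω, L φ = SmoothCompact.laplacianLp Ω φ)
    {S : BeppoLevi Ω →L[ℝ] Lp ℝ p (volume.restrict (Ω : Set (EuclideanSpace ℝ (Fin N))))}
    (hS : ∀ φ : SmoothCompact Ω, S φ = SmoothCompact.toLp Ω p φ)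
    (u : BeppoLevi Ω) (ψ : SmoothCompact Ω) :
    ∫ x in (Ω : Set (EuclideanSpace ℝ (Fin N))), L u x * ψ.toFun x
      = ∫ x in (Ω : Set (EuclideanSpace ℝ (Fin N))), S u x * Δ ψ.toFun x := by
  obtain ⟨ℓ₁, h₁⟩ := (ψ.memLp 2).exists_continuousLinearMap_integral_mul
    (p := 2)
  have hψ : MemLp (Δ ψ.toFun) (ENNReal.conjExponent p) volume :=
    ψ.continuous_laplacian.memLp_of_hasCompactSupport ψ.hasCompactSupport_laplacian
  obtain ⟨ℓ₂, h₂⟩ := (hψ.restrict (Ω : Set (EuclideanSpace ℝ (Fin N)))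
    ).exists_continuousLinearMap_integral_mul (p := p)
  rw [← h₁, ← h₂]
  induction u using UniformSpace.Completion.induction_on with
  | hp => exact isClosed_eq (ℓ₁.continuous.comp L.continuous) (ℓ₂.continuous.comp S.continuous)
  | ih φ =>
    rw [h₁, h₂, hL, hS]
    have e1 : ∫ x in (Ω : Set (EuclideanSpace ℝ (Fin N))),
        SmoothCompact.laplacianLp Ω φ x * ψ.toFun x 
        = ∫ x in (Ω : Set (EuclideanSpace ℝ (Fin N))), Δ φ.toFun x * ψ.toFun x  := by
      refine integral_congr_ae ?_
      filter_upwards [φ.memLp_laplacian.coeFn_toLp] with x hx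
      exact congrArg (· * ψ.toFun x) hx
    have e2 : ∫ x in (Ω : Set (EuclideanSpace ℝ (Fin N))),
        SmoothCompact.toLp Ω p φ x * Δ ψ.toFun x 
        = ∫ x in (Ω : Set (EuclideanSpace ℝ (Fin N))), φ.toFun x * Δ ψ.toFun x  := by
      refine integral_congr_ae ?_
      filter_upwards [(φ.memLp p).coeFn_toLp] with x hx
      exact congrArg (· * Δ ψ.toFun x) hx
    rw [e1, e2, setIntegral_eq_integral_of_forall_compl_eq_zero,
      setIntegral_eq_integral_of_forall_compl_eq_zero,
      integral_laplacian_mul φ.contDiff φ.hasCompactSupport ψ.contDiff ψ.hasCompactSupport]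
    · intro x hx
      rw [Function.notMem_support.1 fun h => hx (ψ.support_laplacian_subset h), mul_zero]
    · intro x hx
      rw [Function.notMem_support.1 fun h => hx (φ.support_laplacian_subset h), zero_mul]

/-- If `S u = 0`, the weak identity shows that `L u` annihilates every test function, so `L u = 0`
almost everywhere; `L` is an isometry, hence `u = 0`. -/
theorem BeppoLevi.injective_extension {p : ℝ≥0∞} [Fact (1 ≤ p)]
    {S : BeppoLevi Ω →L[ℝ] Lp ℝ p (volume.restrict (Ω : Set (EuclideanSpace ℝ (Fin N))))}
    (hS : ∀ φ : SmoothCompact Ω, S φ = SmoothCompact.toLp Ω p φ) : Function.Injective S := by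
  obtain ⟨L, hL⟩ := BeppoLevi.exists_extension (SmoothCompact.laplacianLp Ω) (C := 1)
    fun φ => by rw [one_mul]; rfl
  have hnorm (u : BeppoLevi Ω) : ‖L u‖ = ‖u‖ := by
    induction u using UniformSpace.Completion.induction_on with
    | hp => exact isClosed_eq L.continuous.norm continuous_norm
    | ih φ => rw [hL, UniformSpace.Completion.norm_coe]; rfl
  refine (injective_iff_map_eq_zero S).2 fun u hu => ?_
  rw [← norm_eq_zero, ← hnorm, norm_eq_zero, Lp.eq_zero_iff_ae_eq_zero]
  rw [EventuallyEq, ae_restrict_iff' Ω.isOpen.measurableSet]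
  refine Ω.isOpen.ae_eq_zero_of_integral_contDiff_smul_eq_zero
    ((locallyIntegrableOn_of_locallyIntegrable_restrict
      ((Lp.memLp (L u)).locallyIntegrable (by norm_num)))) fun g hg hgc hgs => ?_
  let ψ : SmoothCompact Ω := (⟨g, hg, hgc, hgs⟩ : 𝓓(Ω, ℝ))
  have h := integral_mul_laplacian_eq hL hS u ψ
  have h0 : ∫ x in (Ω : Set (EuclideanSpace ℝ (Fin N))), S u x * Δ ψ.toFun x = 0 := by
    rw [hu]
    refine integral_eq_zero_of_ae ?_
    filter_upwards [Lp.coeFn_zero ℝ p (volume.restrict (Ω : Set (EuclideanSpace ℝ (Fin N))))]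
      with x hx
    rw [hx, Pi.zero_apply, zero_mul]
  rw [h0] at h
  rw [← h, setIntegral_eq_integral_of_forall_compl_eq_zero]
  · exact integral_congr_ae (.of_forall fun x => mul_comm _ _)
  · intro x hx
    rw [show ψ.toFun x = 0 from image_eq_zero_of_notMem_tsupport fun h => hx (hgs h), mul_zero]

/-- A constant for the embedding of `D^{2,2}_0(Ω)` into the Lorentz space. -/
noncomputable def embeddingConst (N : ℕ) : ℝ≥0∞ :=
  potentialConst (volume : Measure (EuclideanSpace ℝ (Fin N)))
    * ENNReal.ofReal (2 + 1 / (1 / 2 - 2 / (N : ℝ))) * (N : ℝ≥0∞) ^ 2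

theorem embeddingConst_ne_top (N : ℕ) : embeddingConst N ≠ ∞ :=
  ENNReal.mul_ne_top (ENNReal.mul_ne_top potentialConst_ne_top ENNReal.ofReal_ne_top)
    (ENNReal.pow_ne_top (ENNReal.natCast_ne_top N))

theorem BeppoLevi.lorentzNorms_le (hN : 5 ≤ N) {p : ℝ≥0∞} [Fact (1 ≤ p)] (hp : p ≠ ∞)
    {S : BeppoLevi Ω →L[ℝ] Lp ℝ p (volume.restrict (Ω : Set (EuclideanSpace ℝ (Fin N))))}
    (hS : ∀ φ : SmoothCompact Ω, S φ = SmoothCompact.toLp Ω p φ) (u : BeppoLevi Ω) :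
    lorentzQuasiNorm (2 * (N : ℝ) / ((N : ℝ) - 4)) 2
        (volume.restrict (Ω : Set (EuclideanSpace ℝ (Fin N)))) (S u)
      ≤ embeddingConst N * ‖u‖ₑ ∧
    lorentzNorm (2 * (N : ℝ) / ((N : ℝ) - 4)) 2
        (volume.restrict (Ω : Set (EuclideanSpace ℝ (Fin N)))) (S u)
      ≤ ENNReal.ofReal (1 / (2 / (N : ℝ) + 1 / 2)) * (embeddingConst N * ‖u‖ₑ) := by
  have h : (5 : ℝ) ≤ N := by exact_mod_cast hN
  have hfin : (Module.finrank ℝ (EuclideanSpace ℝ (Fin N)) : ℝ) = N := by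
    rw [finrank_euclideanSpace_fin]
  obtain ⟨φ, hφ⟩ := BeppoLevi.exists_seq_tendsto u
  have hSφ : Tendsto (fun n => SmoothCompact.toLp Ω p (φ n)) atTop (𝓝 (S u)) := by
    simp_rw [← hS]
    exact (S.continuous.tendsto u).comp hφ
  -- Convergence in `L^p` implies convergence in measure, hence almost everywhere along a
  -- subsequence.
  obtain ⟨k, hk, hlim⟩ := (tendstoInMeasure_of_tendsto_Lp hSφ).exists_seq_tendsto_ae
  have hcoe : ∀ᵐ x ∂volume.restrict (Ω : Set (EuclideanSpace ℝ (Fin N))),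
      ∀ n, SmoothCompact.toLp Ω p (φ (k n)) x = (φ (k n)).toFun x :=
    ae_all_iff.2 fun n => ((φ (k n)).memLp p).coeFn_toLp
  have hlim' : ∀ᵐ x ∂volume.restrict (Ω : Set (EuclideanSpace ℝ (Fin N))),
      Tendsto (fun n => (φ (k n)).toFun x) atTop (𝓝 (S u x)) := by
    filter_upwards [hlim, hcoe] with x hx hx'
    simpa only [hx'] using hx
  have hm : Tendsto (fun n => (N : ℝ≥0∞) ^ 2 * ‖φ (k n)‖ₑ) atTop (𝓝 ((N : ℝ≥0∞) ^ 2 * ‖u‖ₑ)) := by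
    refine ENNReal.Tendsto.const_mul ?_ (Or.inr (ENNReal.pow_ne_top (ENNReal.natCast_ne_top N)))
    have := (continuous_enorm.tendsto u).comp (hφ.comp hk.tendsto_atTop)
    refine this.congr fun n => ?_
    rw [← ofReal_norm (φ (k n)), ← UniformSpace.Completion.norm_coe, ofReal_norm]
    rfl
  have hmain := lorentzNorms_le_of_tendsto (by rw [hfin]; linarith) Ω.isOpen.measurableSet
    (fun n => (φ (k n)).contDiff_two) (fun n => (φ (k n)).hasCompactSupport)
    (Lp.stronglyMeasurable (S u)).measurable (zero_lt_one.trans_le Fact.out).ne' hp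
    (Lp.memLp (S u)) hlim' (fun n => (φ (k n)).eLpNorm_fderiv_fderiv_le) hm
    (q := 2 * (N : ℝ) / ((N : ℝ) - 4)) (by
      rw [hfin]
      have : (N : ℝ) - 4 ≠ 0 := by linarith
      field_simp
      ring)
  rw [hfin] at hmain
  rw [embeddingConst, mul_assoc _ ((N : ℝ≥0∞) ^ 2)]
  exact hmain

end Embedding

theorem mainTheorem5 (N : ℕ) (hN : 5 ≤ N) :
    ∃ C : ℝ≥0, ∀ Ω : TopologicalSpace.Opens (EuclideanSpace ℝ (Fin N)),
      ∃ J : BeppoLevi Ω →ₗ[ℝ]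
          (EuclideanSpace ℝ (Fin N) →ₘ[volume.restrict (Ω : Set (EuclideanSpace ℝ (Fin N)))] ℝ),
        (∀ φ : SmoothCompact Ω,
          ⇑(J (φ : BeppoLevi Ω))
            =ᵐ[volume.restrict (Ω : Set (EuclideanSpace ℝ (Fin N)))] φ.toFun) ∧
        Function.Injective J ∧
        (∀ u : BeppoLevi Ω,
          J u ∈ lorentzSpace (2 * (N : ℝ) / ((N : ℝ) - 4)) 2
            (volume.restrict (Ω : Set (EuclideanSpace ℝ (Fin N))))) ∧
        (∀ u : BeppoLevi Ω,
          lorentzQuasiNorm (2 * (N : ℝ) / ((N : ℝ) - 4)) 2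
            (volume.restrict (Ω : Set (EuclideanSpace ℝ (Fin N)))) (J u) ≤ C * ‖u‖ₑ) ∧
        (∀ u : BeppoLevi Ω,
          lorentzNorm (2 * (N : ℝ) / ((N : ℝ) - 4)) 2
            (volume.restrict (Ω : Set (EuclideanSpace ℝ (Fin N)))) (J u) ≤ C * ‖u‖ₑ) := by
  have : Fact (1 ≤ (criticalExponent N : ℝ≥0∞)) :=
    ⟨by exact_mod_cast one_le_criticalExponent hN⟩
  obtain ⟨C₀, hC₀⟩ := exists_eLpNorm_criticalExponent_le hN
  set c := ENNReal.ofReal (1 / (2 / (N : ℝ) + 1 / 2))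
  -- The sum of the constants for the quasi-norm and for the norm serves both bounds, and depends on
  -- `N` only.
  set K : ℝ≥0∞ := embeddingConst N + c * embeddingConst N with hK
  have hKt : K ≠ ∞ := ENNReal.add_ne_top.2 ⟨embeddingConst_ne_top N,
    ENNReal.mul_ne_top ENNReal.ofReal_ne_top (embeddingConst_ne_top N)⟩
  refine ⟨K.toNNReal, fun Ω => ?_⟩
  rw [ENNReal.coe_toNNReal hKt]
  obtain ⟨S, hS⟩ := BeppoLevi.exists_extension (SmoothCompact.toLp Ω (criticalExponent N))
    (C := C₀) fun φ => by
      rw [← ENNReal.ofReal_le_ofReal_iff (by positivity), ofReal_norm,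
        ENNReal.ofReal_mul C₀.coe_nonneg, ENNReal.ofReal_coe_nnreal, ofReal_norm]
      refine (Lp.enorm_toLp (φ.memLp _)).trans_le ((eLpNorm_mono_measure _
        Measure.restrict_le_self).trans (hC₀ Ω φ))
  have hle := BeppoLevi.lorentzNorms_le hN ENNReal.coe_ne_top hS
  have hquasi (u : BeppoLevi Ω) := (hle u).1.trans
    (mul_le_mul_left (le_self_add : embeddingConst N ≤ K) ‖u‖ₑ)
  have hnorm (u : BeppoLevi Ω) := (hle u).2.trans ((mul_assoc c _ ‖u‖ₑ).symm.trans_le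
    (mul_le_mul_left (le_add_self : c * embeddingConst N ≤ K) ‖u‖ₑ))
  refine ⟨⟨⟨fun u => (S u).1, fun u v => ?_⟩, fun r u => ?_⟩, fun φ => ?_, fun u v huv => ?_,
    fun u => ?_, hquasi, hnorm⟩
  · exact congrArg Subtype.val (S.map_add u v)
  · exact congrArg Subtype.val (S.map_smul r u)
  · have h : ⇑(S φ) =ᵐ[volume.restrict (Ω : Set (EuclideanSpace ℝ (Fin N)))] φ.toFun := by
      rw [hS]
      exact (φ.memLp _).coeFn_toLp
    exact h
  · exact BeppoLevi.injective_extension hS (Subtype.ext huv)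
  · exact (hquasi u).trans_lt (ENNReal.mul_lt_top hKt.lt_top enorm_lt_top)
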